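/- **Setting.** Let $1\le K\le p$ and $n\ge 1$ be integers, $A\in\mathbb R^{p\times K}$, $\beta\in\mathbb R^K$. Let $Z\in\mathbb R^K$, $E\in\mathbb R^p$, $\varepsilon\in\mathbb R$ be mutually independent, mean zero, with finite second moments, and let $(X,y)$ follow the factor regression model $$X=AZ+E,\qquad y=Z^\top\beta+\varepsilon .$$ Write $\Sigma_X,\Sigma_Z,\Sigma_E$ for the covariance matrices of $X,Z,E$, $\sigma_y^2=\mathrm{Var}(y)$, $\sigma_\varepsilon^2=\mathrm{Var}(\varepsilon)$, $\|v\|_Q^2=v^\top Qv$, $\lambda_1(Q)\ge\lambda_2(Q)\ge\dots$ for the ordered eigenvalues of a symmetric matrix $Q$, $\Sigma^{1/2}$ for the positive semidefinite square root, and $\|U\|_{\psi_2}=\inf\{t>0:\mathbb E\exp(U^2/t^2)\le 2\}$ for the sub-Gaussian norm of a real random variable $U$. Let $$\xi=\frac{\lambda_K(A\Sigma_ZA^\top)}{\|\Sigma_E\|},\qquad \kappa(\Sigma_E)=\frac{\lambda_1(\Sigma_E)}{\lambda_p(\Sigma_E)} ,$$ where $\|\cdot\|$ is the operator norm. The data are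 $n$ pairs $X_i=AZ_i+E_i$, $y_i=Z_i^\top\beta+\varepsilon_i$, where $(Z_i,E_i,\varepsilon_i)$, $i=1,\dots,n$, are i.i.d. copies of $(Z,E,\varepsilon)$. Let $\mathbf X\in\mathbb R^{n\times p}$ be the matrix with rows $X_i$, $\mathbf y=(y_1,\dots,y_n)^\top$, $\widehat\alpha=\mathbf X^+\mathbf y$ with $\mathbf X^+$ the Moore-Penrose pseudo-inverse, and $R(\alpha)=\mathbb E_{(X,y)}[(X^\top\alpha-y)^2]$, the expectation being over a new pair $(X,y)$ independent of the data, so that $R(\widehat\alpha)$ is a function of the data. **Assumptions.** Let $M>0$. 1. $X=\Sigma_X^{1/2}\tilde X$ and $y=\sigma_y\tilde y$ almost surely, where $\tilde X\in\mathbb R^p$ has independent entries, and the entries of $\tilde X$ and $\tilde y$ have mean zero, unit variance and $\psi_2$-norm at most $M$. 2. $A$ and $\Sigma_Z$ have rank $K$. 3. $E=\Sigma_E^{1/2}\tilde E$, $Z=\Sigma_Z^{1/2}\tilde Z$ and $\varepsilon=\sigma_\varepsilon\tilde\varepsilon$ almost surely, where $\tilde E\in\mathbb R^p$ has independent entries with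 mean zero, unit variance and $\psi_2$-norm at most $M$, and the entries of $\tilde Z\in\mathbb R^K$, and $\tilde\varepsilon$, have mean zero and $\psi_2$-norm at most $M$. **Theorem.** For every $M>0$ there are constants $C,c,C'>0$, depending only on $M$, such that whenever the above assumptions hold and $n>C\,p$ (and $p\ge K$), with probability at least $1-c/n$ over the data, $$R(\widehat\alpha)-\sigma_\varepsilon^2\;\le\; C'\left(\kappa(\Sigma_E)\,\frac{\|\beta\|_{\Sigma_Z}^2}{\xi}+\frac pn\,\sigma_\varepsilon^2\log n\right).$$ Here, if $\Sigma_E=0$, then $\xi=\infty$ and the first term on the right is $0$; if $\Sigma_E\ne0$ is singular, then $\kappa(\Sigma_E)=\infty$ and the first term is $+\infty$ when $\beta\neq0$ and $0$ when $\beta=0$. -/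

import Mathlib

open MeasureTheory ProbabilityTheory
open scoped ENNReal

namespace FactorRegression

section LinearAlgebra

/-- `G` is a Moore-Penrose inverse of the real matrix `B`: the four Penrose conditions. -/
structure IsMoorePenrose {m k : ℕ} (B : Matrix (Fin m) (Fin k) ℝ)
    (G : Matrix (Fin k) (Fin m) ℝ) : Prop where
  mul_mul_self : B * G * B = B
  self_mul_mul : G * B * G = G
  symm_left : (B * G).IsSymm
  symm_right : (G * B).IsSymm

theorem IsMoorePenrose.unique {m k : ℕ} {B : Matrix (Fin m) (Fin k) ℝ}
    {G H : Matrix (Fin k) (Fin m) ℝ} (hG : IsMoorePenrose B G) (hH : IsMoorePenrose B H) :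
    G = H := by
  have h1 : B * G = B * H := by
    have e1 : B * G = (B * H) * (B * G) := by
      rw [← Matrix.mul_assoc, hH.mul_mul_self]
    have e2 : B * H = (B * G) * (B * H) := by
      rw [← Matrix.mul_assoc, hG.mul_mul_self]
    have e3 := congrArg Matrix.transpose e2
    rw [Matrix.transpose_mul (B * G) (B * H), hH.symm_left.eq, hG.symm_left.eq] at e3
    rw [e1, ← e3]
  have h2 : G * B = H * B := by
    have e1 : G * B = (G * B) * (H * B) := by
      rw [Matrix.mul_assoc, ← Matrix.mul_assoc B H B, hH.mul_mul_self]
    have e2 : H * B = (H * B) * (G * B) := by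
      rw [Matrix.mul_assoc, ← Matrix.mul_assoc B G B, hG.mul_mul_self]
    have e3 := congrArg Matrix.transpose e2
    rw [Matrix.transpose_mul (H * B) (G * B), hH.symm_right.eq, hG.symm_right.eq] at e3
    rw [e1, ← e3]
  calc G = G * B * G := hG.self_mul_mul.symm
    _ = H * (B * G) := by rw [h2, Matrix.mul_assoc]
    _ = H * B * H := by rw [h1, Matrix.mul_assoc]
    _ = H := hH.self_mul_mul

theorem exists_isMoorePenrose {m k : ℕ} (B : Matrix (Fin m) (Fin k) ℝ) :
    ∃ G, IsMoorePenrose B G := by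
  have hH : (B.transpose * B).IsHermitian := by
    have := Matrix.isHermitian_conjTranspose_mul_self B
    rwa [Matrix.conjTranspose_eq_transpose_of_trivial] at this
  obtain ⟨U, d, hU, hUd⟩ : ∃ (U : Matrix (Fin k) (Fin k) ℝ) (d : Fin k → ℝ),
      U.transpose * U = 1 ∧ B.transpose * B = U * Matrix.diagonal d * U.transpose := by
    refine ⟨hH.eigenvectorUnitary, hH.eigenvalues, ?_, ?_⟩
    · have := Unitary.coe_star_mul_self hH.eigenvectorUnitary
      rwa [Matrix.star_eq_conjTranspose, Matrix.conjTranspose_eq_transpose_of_trivial] at this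
    · have := hH.spectral_theorem
      rw [Unitary.conjStarAlgAut_apply, Matrix.star_eq_conjTranspose,
        Matrix.conjTranspose_eq_transpose_of_trivial] at this
      exact this
  set D := Matrix.diagonal d with hD
  set D' := Matrix.diagonal (fun i => (d i)⁻¹) with hD'
  have hDDD : D * D' * D = D := by
    simp only [hD, hD', Matrix.diagonal_mul_diagonal, mul_inv_mul_cancel]
  have hDDD' : D' * D * D' = D' := by
    simp only [hD, hD', Matrix.diagonal_mul_diagonal]
    congr 1; ext i
    by_cases h : d i = 0 <;> simp [h]
  have hcomm : D * D' = D' * D := by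
    simp only [hD, hD', Matrix.diagonal_mul_diagonal, mul_comm]
  have hcancel : ∀ S T : Matrix (Fin k) (Fin k) ℝ,
      (U * S * U.transpose) * (U * T * U.transpose) = U * (S * T) * U.transpose := by
    intro S T
    calc (U * S * U.transpose) * (U * T * U.transpose)
        = U * S * (U.transpose * U) * T * U.transpose := by simp only [Matrix.mul_assoc]
      _ = _ := by rw [hU]; simp only [Matrix.mul_assoc, Matrix.one_mul]
  set H := B.transpose * B with hHdef
  set G := U * D' * U.transpose with hG
  have hGT : G.transpose = G := by
    simp only [hG, hD', Matrix.transpose_mul, Matrix.transpose_transpose,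
      Matrix.diagonal_transpose, Matrix.mul_assoc]
  have hHT : H.transpose = H := by
    simp only [hHdef, Matrix.transpose_mul, Matrix.transpose_transpose]
  have hHGH : H * G * H = H := by rw [hUd, hG, hcancel, hcancel, hDDD]
  have hGHG : G * H * G = G := by rw [hUd, hG, hcancel, hcancel, hDDD']
  have hGH : H * G = G * H := by rw [hUd, hG, hcancel, hcancel, hcomm]
  have hB : B * G * H = B := by
    have hz : (B * G * H - B).transpose * (B * G * H - B) = 0 := by
      have : (B * G * H - B).transpose = H * G * B.transpose - B.transpose := by
        rw [Matrix.transpose_sub, Matrix.transpose_mul (B * G) H, Matrix.transpose_mul B G, hGT,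
          hHT, Matrix.mul_assoc H G]
      rw [this, Matrix.sub_mul, Matrix.mul_sub, Matrix.mul_sub]
      have a1 : H * G * B.transpose * (B * G * H) = H := by
        calc H * G * B.transpose * (B * G * H) = H * G * H * G * H := by
              rw [hHdef]; simp only [Matrix.mul_assoc]
          _ = H := by rw [hHGH, hHGH]
      have a2 : H * G * B.transpose * B = H := by rw [Matrix.mul_assoc (H * G), ← hHdef, hHGH]
      have a3 : B.transpose * (B * G * H) = H := by
        rw [← Matrix.mul_assoc, ← Matrix.mul_assoc B.transpose, ← hHdef, hHGH]
      rw [a1, a2, a3, ← hHdef]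
      simp
    have := (Matrix.conjTranspose_mul_self_eq_zero (A := B * G * H - B)).1 (by
      rwa [Matrix.conjTranspose_eq_transpose_of_trivial])
    exact sub_eq_zero.1 this
  refine ⟨G * B.transpose, ?_, ?_, ?_, ?_⟩
  · rw [← Matrix.mul_assoc, Matrix.mul_assoc (B * G), ← hHdef, hB]
  · rw [Matrix.mul_assoc G B.transpose B, ← hHdef, ← Matrix.mul_assoc, hGHG]
  · rw [Matrix.IsSymm, Matrix.transpose_mul, Matrix.transpose_mul G, Matrix.transpose_transpose,
      hGT, Matrix.mul_assoc]
  · rw [Matrix.IsSymm, Matrix.mul_assoc, ← hHdef, Matrix.transpose_mul, hGT, hHT, hGH]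

/-- The Moore-Penrose pseudo-inverse of a real matrix. -/
noncomputable def pinv {m k : ℕ} (B : Matrix (Fin m) (Fin k) ℝ) : Matrix (Fin k) (Fin m) ℝ :=
  Classical.choose (exists_isMoorePenrose B)

theorem pinv_spec {m k : ℕ} (B : Matrix (Fin m) (Fin k) ℝ) : IsMoorePenrose B (pinv B) :=
  Classical.choose_spec (exists_isMoorePenrose B)

/-- The `k`-th largest eigenvalue (`k = 1, …, d`, counted with multiplicity) of a symmetric
`d × d` real matrix. -/
noncomputable def ordEig {d : ℕ} (Q : Matrix (Fin d) (Fin d) ℝ) (k : ℕ) : ℝ :=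
  open Classical in
  if h : Q.IsHermitian ∧ 1 ≤ k ∧ k ≤ d then
    h.1.eigenvalues₀ ⟨k - 1, by rw [Fintype.card_fin]; omega⟩
  else 0

/-- The Euclidean operator norm of a square matrix. -/
noncomputable def opNorm {d : ℕ} (Q : Matrix (Fin d) (Fin d) ℝ) : ℝ :=
  ‖Matrix.toEuclideanCLM (n := Fin d) (𝕜 := ℝ) Q‖

/-- `‖v‖²_Q = vᵀ Q v`. -/
def sqNormOf {d : ℕ} (Q : Matrix (Fin d) (Fin d) ℝ) (v : Fin d → ℝ) : ℝ :=
  v ⬝ᵥ Q.mulVec v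

open scoped MatrixOrder in
/-- The positive semidefinite square root of a positive semidefinite matrix. -/
noncomputable def psdSqrt {d : ℕ} (Q : Matrix (Fin d) (Fin d) ℝ) : Matrix (Fin d) (Fin d) ℝ :=
  CFC.sqrt Q

/-- Condition number `λ₁(Q) / λ_d(Q)` of a positive semidefinite `d × d` matrix, with values
in `[0, ∞]`; it is `∞` for a singular nonzero `Q`. -/
noncomputable def condNumber {d : ℕ} (Q : Matrix (Fin d) (Fin d) ℝ) : ℝ≥0∞ :=
  ENNReal.ofReal (ordEig Q 1) / ENNReal.ofReal (ordEig Q d)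

/-- Signal-to-noise ratio `ξ = λ_K(A Σ_Z Aᵀ) / ‖Σ_E‖`, with values in `[0, ∞]`; it is `∞` when
`Σ_E = 0` and the numerator is positive. -/
noncomputable def snr {p K : ℕ} (A : Matrix (Fin p) (Fin K) ℝ)
    (SigmaZ : Matrix (Fin K) (Fin K) ℝ) (SigmaE : Matrix (Fin p) (Fin p) ℝ) : ℝ≥0∞ :=
  ENNReal.ofReal (ordEig (A * SigmaZ * A.transpose) K) / ENNReal.ofReal (opNorm SigmaE)

end LinearAlgebra

section Probability

variable {Ω : Type*} [MeasurableSpace Ω]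

/-- The covariance matrix of a random vector. -/
noncomputable def covMat {d : ℕ} (P : Measure Ω) (V : Ω → Fin d → ℝ) :
    Matrix (Fin d) (Fin d) ℝ :=
  Matrix.of fun i j => cov[fun ω => V ω i, fun ω => V ω j; P]

/-- The sub-Gaussian norm `‖U‖_{ψ₂} = inf {t > 0 : 𝔼 exp(U² / t²) ≤ 2}`, with values in `[0, ∞]`
(the infimum of the empty set is `∞`). -/
noncomputable def psi2Norm (P : Measure Ω) (U : Ω → ℝ) : ℝ≥0∞ :=
  ⨅ (t : ℝ) (_ : 0 < t ∧ ∫⁻ ω, ENNReal.ofReal (Real.exp (U ω ^ 2 / t ^ 2)) ∂P ≤ 2),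
    ENNReal.ofReal t

/-- A real random variable with zero mean and sub-Gaussian norm at most `M`. -/
structure IsCenteredSubGaussian (P : Measure Ω) (M : ℝ) (U : Ω → ℝ) : Prop where
  measurable : Measurable U
  mean_zero : ∫ ω, U ω ∂P = 0
  psi2_le : psi2Norm P U ≤ ENNReal.ofReal M

/-- A real random variable with zero mean, unit variance and sub-Gaussian norm at most `M`. -/
structure IsStandardSubGaussian (P : Measure Ω) (M : ℝ) (U : Ω → ℝ) : Prop
    extends IsCenteredSubGaussian P M U where
  var_one : Var[U; P] = 1

/-- The features `X = A Z + E`. -/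
def features {p K : ℕ} (A : Matrix (Fin p) (Fin K) ℝ) (Z : Ω → Fin K → ℝ)
    (E : Ω → Fin p → ℝ) : Ω → Fin p → ℝ :=
  fun ω => A.mulVec (Z ω) + E ω

/-- The response `y = Zᵀ β + ε`. -/
def response {K : ℕ} (β : Fin K → ℝ) (Z : Ω → Fin K → ℝ) (ε : Ω → ℝ) : Ω → ℝ :=
  fun ω => Z ω ⬝ᵥ β + ε ω

/-- The conditions on the latent vector `Z` and the noise terms `E`, `ε` in the factor regression
model: square integrable, mean zero, and mutually independent. -/
structure IsFactorTriple {p K : ℕ} (P : Measure Ω) (Z : Ω → Fin K → ℝ)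
    (E : Ω → Fin p → ℝ) (ε : Ω → ℝ) : Prop where
  measurable_Z : Measurable Z
  measurable_E : Measurable E
  measurable_ε : Measurable ε
  memLp_Z : ∀ a, MemLp (fun ω => Z ω a) 2 P
  memLp_E : ∀ j, MemLp (fun ω => E ω j) 2 P
  memLp_ε : MemLp ε 2 P
  mean_Z : ∀ a, ∫ ω, Z ω a ∂P = 0
  mean_E : ∀ j, ∫ ω, E ω j ∂P = 0
  mean_ε : ∫ ω, ε ω ∂P = 0
  indep_E_ε : IndepFun E ε P
  indep_Z_noise : IndepFun Z (fun ω => (E ω, ε ω)) P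

/-- Joint distributional assumption on `(X, y)`: `X = Σ_X^{1/2} X̃` and `y = σ_y ỹ`, where `X̃` has
independent entries, and the entries of `X̃` and `ỹ` have zero mean, unit variance and
sub-Gaussian norms at most `M`. -/
def SubGaussianData {p : ℕ} (P : Measure Ω) (M : ℝ) (X : Ω → Fin p → ℝ) (y : Ω → ℝ) : Prop :=
  (∃ Xt : Ω → Fin p → ℝ,
    iIndepFun (fun j ω => Xt ω j) P ∧
    (∀ j, IsStandardSubGaussian P M (fun ω => Xt ω j)) ∧
    ∀ᵐ ω ∂P, X ω = (psdSqrt (covMat P X)).mulVec (Xt ω)) ∧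
  ∃ yt : Ω → ℝ, IsStandardSubGaussian P M yt ∧ ∀ᵐ ω ∂P, y ω = √(Var[y; P]) * yt ω

/-- Distributional assumption on the factor model: `E = Σ_E^{1/2} Ẽ` where `Ẽ` has independent
entries with zero mean, unit variance and sub-Gaussian norms at most `M`; `Z = Σ_Z^{1/2} Z̃` and
`ε = σ_ε ε̃`, where `Z̃` and `ε̃` have zero mean and (entrywise) sub-Gaussian norms at most `M`. -/
def SubGaussianFactors {p K : ℕ} (P : Measure Ω) (M : ℝ) (Z : Ω → Fin K → ℝ)
    (E : Ω → Fin p → ℝ) (ε : Ω → ℝ) : Prop :=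
  (∃ Et : Ω → Fin p → ℝ,
    iIndepFun (fun j ω => Et ω j) P ∧
    (∀ j, IsStandardSubGaussian P M (fun ω => Et ω j)) ∧
    ∀ᵐ ω ∂P, E ω = (psdSqrt (covMat P E)).mulVec (Et ω)) ∧
  (∃ Zt : Ω → Fin K → ℝ,
    (∀ a, IsCenteredSubGaussian P M (fun ω => Zt ω a)) ∧
    ∀ᵐ ω ∂P, Z ω = (psdSqrt (covMat P Z)).mulVec (Zt ω)) ∧
  ∃ εt : Ω → ℝ, IsCenteredSubGaussian P M εt ∧ ∀ᵐ ω ∂P, ε ω = √(Var[ε; P]) * εt ω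

/-- `(Zs i, Es i, εs i)`, `i = 1, …, n`, defined on `(Ω', P')`, are independent copies of
`(Z, E, ε)`. -/
structure IsIIDSample {Ω' : Type*} [MeasurableSpace Ω'] {n p K : ℕ}
    (P : Measure Ω) (Z : Ω → Fin K → ℝ) (E : Ω → Fin p → ℝ) (ε : Ω → ℝ)
    (P' : Measure Ω') (Zs : Fin n → Ω' → Fin K → ℝ) (Es : Fin n → Ω' → Fin p → ℝ)
    (εs : Fin n → Ω' → ℝ) : Prop where
  indep : iIndepFun (fun i ω => (Zs i ω, Es i ω, εs i ω)) P'
  identDistrib : ∀ i, IdentDistrib (fun ω => (Zs i ω, Es i ω, εs i ω))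
    (fun ω => (Z ω, E ω, ε ω)) P' P

/-- The prediction risk `R(α) = 𝔼 (Xᵀ α - y)²`, an expectation over the population `(X, y)`. -/
noncomputable def risk {p : ℕ} (P : Measure Ω) (X : Ω → Fin p → ℝ) (y : Ω → ℝ)
    (α : Fin p → ℝ) : ℝ :=
  ∫ ω, (X ω ⬝ᵥ α - y ω) ^ 2 ∂P

/-- The estimator `α̂ = 𝐗⁺ 𝐲` computed at the sample point `ω`; row `i` of `𝐗` is `X_i`. -/
noncomputable def gls {n p : ℕ} (Xs : Fin n → Ω → Fin p → ℝ) (ys : Fin n → Ω → ℝ) (ω : Ω) :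
    Fin p → ℝ :=
  (pinv (Matrix.of fun i j => Xs i ω j)).mulVec fun i => ys i ω

end Probability

end FactorRegression

/-! Since `A` and `Σ_Z` have full rank `K`, there is a vector `v` with `Aᵀ v = β`. Then `y = Xᵀ v +
ε - vᵀ E`: a linear model in `X` with noise `ε`, perturbed by the error `vᵀ E`, which may be
correlated with `X`. As `ε` is uncorrelated with `Z` and `E`, the excess risk of `α` is at most `2
‖α - v‖²_{Σ_X} + 2 ‖v‖²_{Σ_E}`.

Bias. Choose `v` in the range of `Q = A Σ_Z Aᵀ`. There `Q` is bounded below by its `K`-th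
eigenvalue, so `λ_K(Q) ‖v‖² ≤ vᵀ Q v = ‖β‖²_{Σ_Z}` and hence `‖v‖²_{Σ_E} ≤ ‖β‖²_{Σ_Z} / ξ`. The
factor `κ(Σ_E)` enters only through `κ ≥ 1`.

Estimation. With `W_i` the whitened features and `d = α̂ - v`, the normal equations give a
deterministic bound (`pinv_mulVec_sub_le`) of `‖d‖²_{Σ_X}` by `n⁻² ∑_j (∑_i W_ij ε_i)²` and `n⁻¹ ∑_i
(vᵀ E_i)²`, as soon as the empirical Gram form is at least half the population one. Three events are
needed, each from Bernstein's inequality for products of sub-Gaussians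
(`measureReal_abs_sum_mul_sub_ge_le`): the Gram bound, by a union over a `1/2`-net of at most `5 ^
p` points, affordable because `n > C p`; coordinatewise noise correlations of order `σ_ε √(n log
n)`, by a union over `p ≤ n` coordinates, which produces the `(p / n) σ_ε² log n` term; and `∑_i (vᵀ
E_i)² ≤ 2 n ‖v‖²_{Σ_E}`.

Whitening uses the pseudo-inverse of `Σ_X^{1/2}`, so `Σ_X` may be singular. -/

namespace FactorRegression

/-! ### Sub-Gaussian variables and Bernstein's inequality for their products. -/

section SubGaussian

open Real
open scoped NNReal

/-- For centred `U` this trades `𝔼 exp (l U)` for `𝔼 exp (l² U²)`, with no linear term left after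
integration. -/
theorem exp_le_add_exp_sq (x : ℝ) : exp x ≤ x + exp (x ^ 2) := by
  have h2 : x ^ 2 + 1 ≤ exp (x ^ 2) := add_one_le_exp _
  rcases le_total x (-1) with h | h
  · have : exp x ≤ 1 := exp_le_one_iff.2 (by linarith)
    nlinarith
  rcases le_total x 1 with h1 | h1
  · have h3 := Real.abs_exp_sub_one_sub_id_le (abs_le.2 ⟨h, h1⟩)
    have := (abs_le.1 h3).2
    linarith
  · have : exp x ≤ exp (x ^ 2) := exp_le_exp.2 (by nlinarith)
    linarith

theorem exp_mul_le_convex {a : ℝ} (h0 : 0 ≤ a) (h1 : a ≤ 1) (y : ℝ) :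
    exp (a * y) ≤ 1 - a + a * exp y := by
  have h := convexOn_exp.2 (Set.mem_univ y) (Set.mem_univ 0) h0 (sub_nonneg.2 h1) (by ring)
  simp only [smul_eq_mul, mul_zero, add_zero, exp_zero, mul_one] at h
  linarith

variable {Ω : Type*} [MeasurableSpace Ω] {P : Measure Ω}

theorem integrable_exp_sq_of_lintegral_le {f : Ω → ℝ} (hf : AEMeasurable f P)
    (h : ∫⁻ ω, ENNReal.ofReal (exp (f ω)) ∂P ≤ 2) :
    Integrable (fun ω => exp (f ω)) P ∧ ∫ ω, exp (f ω) ∂P ≤ 2 := by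
  have hm : AEMeasurable (fun ω => exp (f ω)) P := measurable_exp.comp_aemeasurable hf
  have hi : Integrable (fun ω => exp (f ω)) P :=
    (lintegral_ofReal_ne_top_iff_integrable hm.aestronglyMeasurable
      (ae_of_all _ fun ω => (exp_pos _).le)).1 (ne_top_of_le_ne_top (by simp) h)
  refine ⟨hi, ?_⟩
  rw [integral_eq_lintegral_of_nonneg_ae (ae_of_all _ fun ω => (exp_pos _).le)
    hm.aestronglyMeasurable]
  exact (ENNReal.toReal_mono (by simp) h).trans (by simp)

theorem IsCenteredSubGaussian.hasSubgaussianMGF [IsProbabilityMeasure P] {M : ℝ} (hM : 0 < M)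
    {U : Ω → ℝ} (h : IsCenteredSubGaussian P M U) :
    HasSubgaussianMGF U (8 * M ^ 2).toNNReal P := by
  -- The infimum defining the norm need not be attained at `M`; doubling leaves room for an
  -- admissible `t < 2 M`.
  obtain ⟨t, ht⟩ := iInf_lt_iff.1 (h.psi2_le.trans_lt
    ((ENNReal.ofReal_lt_ofReal_iff (by linarith : 0 < 2 * M)).2 (by linarith : M < 2 * M)))
  obtain ⟨⟨ht0, ht2⟩, hlt⟩ := iInf_lt_iff.1 ht
  rw [ENNReal.ofReal_lt_ofReal_iff (by linarith)] at hlt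
  have hU := h.measurable
  set y : Ω → ℝ := fun ω => U ω ^ 2 / (2 * M) ^ 2 with hy
  have hyt : ∀ ω, y ω ≤ U ω ^ 2 / t ^ 2 := fun ω => by
    simp only [hy]; gcongr
  obtain ⟨hi, hi2⟩ := integrable_exp_sq_of_lintegral_le (P := P) (f := y)
    (by fun_prop) ((lintegral_mono fun ω => ENNReal.ofReal_le_ofReal
      (exp_le_exp.2 (hyt ω))).trans ht2)
  have hyU : ∀ ω, U ω ^ 2 = 4 * M ^ 2 * y ω := fun ω => by
    simp only [hy]; field_simp; ring
  have hy0 : ∀ ω, 0 ≤ y ω := fun ω => by positivity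
  have hUi : Integrable U P := by
    refine (hi.const_mul (1 + 4 * M ^ 2)).mono' hU.aestronglyMeasurable (ae_of_all _ fun ω => ?_)
    have h1 := add_one_le_exp (y ω)
    have h2 := hyU ω
    rw [norm_eq_abs]
    have h3 : |U ω| ≤ 1 + U ω ^ 2 := by
      rw [← sq_abs]; nlinarith [sq_nonneg (|U ω| - 1), abs_nonneg (U ω)]
    have := hy0 ω
    nlinarith [sq_nonneg M]
  have key : ∀ l ω, l * U ω ≤ 4 * M ^ 2 * l ^ 2 / 2 + (1 / 2) * y ω := fun l ω => by
    have h1 := hyU ω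
    have h2 : 0 ≤ (2 * M * l - U ω / (2 * M)) ^ 2 := sq_nonneg _
    have h3 : (2 * M * l - U ω / (2 * M)) ^ 2 = 4 * M ^ 2 * l ^ 2 - 2 * (l * U ω) + y ω := by
      simp only [hy]; field_simp; ring
    linarith
  have hexp : ∀ l ω, exp (l * U ω) ≤
      exp (4 * M ^ 2 * l ^ 2 / 2) * (1 / 2 + 1 / 2 * exp (y ω)) := fun l ω => by
    refine (exp_le_exp.2 (key l ω)).trans ?_
    rw [exp_add]
    have := exp_mul_le_convex (a := 1 / 2) (by norm_num) (by norm_num) (y ω)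
    gcongr
    linarith
  have hdom : ∀ l, Integrable (fun ω => exp (4 * M ^ 2 * l ^ 2 / 2) *
      (1 / 2 + 1 / 2 * exp (y ω))) P := fun l =>
    ((integrable_const _).add (hi.const_mul _)).const_mul _
  have hint : ∀ l, Integrable (fun ω => exp (l * U ω)) P := fun l => by
    refine (hdom l).mono' (by fun_prop) (ae_of_all _ fun ω => ?_)
    rw [norm_eq_abs, abs_of_pos (exp_pos _)]
    exact hexp l ω
  refine ⟨hint, fun l => ?_⟩
  have hc : ((8 * M ^ 2).toNNReal : ℝ) * l ^ 2 / 2 = 4 * M ^ 2 * l ^ 2 := by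
    rw [coe_toNNReal _ (by positivity)]; ring
  rw [hc]
  -- Put `y = U² / (2M)²`, so `𝔼 exp y ≤ 2` and `l² U² = a y`. If `a ≤ 1`, convexity gives `𝔼 exp (a
  -- y) ≤ 1 + a ≤ exp a`. If `a ≥ 1`, the inequality `l U ≤ a / 2 + y / 2` gives `(3 / 2) exp (a /
  -- 2) ≤ exp a`.
  set a := 4 * M ^ 2 * l ^ 2 with ha
  have ha0 : 0 ≤ a := by positivity
  rcases le_total a 1 with h1 | h1
  · have hle : mgf U P l ≤ ∫ ω, (l * U ω + (1 - a + a * exp (y ω))) ∂P := by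
      refine integral_mono (hint l) ((hUi.const_mul l).add
        ((integrable_const _).add (hi.const_mul a))) fun ω => ?_
      refine (exp_le_add_exp_sq _).trans (add_le_add le_rfl ?_)
      refine le_trans (le_of_eq ?_) (exp_mul_le_convex ha0 h1 (y ω))
      rw [mul_pow, hyU, ha]; ring_nf
    have hia : Integrable (fun ω => 1 - a + a * exp (y ω)) P :=
      (integrable_const _).add (hi.const_mul a)
    rw [integral_add (hUi.const_mul l) hia,
      integral_add (integrable_const _) (hi.const_mul a), integral_const_mul, integral_const_mul,
      h.mean_zero] at hle
    simp only [integral_const, probReal_univ, smul_eq_mul, one_mul] at hle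
    have := add_one_le_exp a
    nlinarith
  · have hle : mgf U P l ≤ ∫ ω, exp (a / 2) * (1 / 2 + 1 / 2 * exp (y ω)) ∂P :=
      integral_mono (hint l) (hdom l) (hexp l)
    rw [integral_const_mul, integral_add (integrable_const _) (hi.const_mul _),
      integral_const_mul] at hle
    simp only [integral_const, probReal_univ, smul_eq_mul, one_mul] at hle
    have h2 := add_one_le_exp (a / 2)
    have h3 : exp a = exp (a / 2) * exp (a / 2) := by rw [← exp_add]; ring_nf
    rw [h3]
    refine hle.trans (mul_le_mul_of_nonneg_left ?_ (exp_pos _).le)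
    linarith

theorem _root_.ProbabilityTheory.HasSubgaussianMGF.mono {U : Ω → ℝ} {c c' : ℝ≥0}
    (h : HasSubgaussianMGF U c P) (hc : c ≤ c') : HasSubgaussianMGF U c' P :=
  ⟨h.integrable_exp_mul, fun t => (h.mgf_le t).trans (exp_le_exp.2 (by gcongr))⟩

/-- Exponential square integrability of sub-Gaussian variables, by integrating the moment
generating function against a Gaussian. -/
theorem _root_.ProbabilityTheory.HasSubgaussianMGF.lintegral_exp_sq_le [IsProbabilityMeasure P]
    {U : Ω → ℝ} {c : ℝ≥0} (hc : 0 < c) (h : HasSubgaussianMGF U c P) :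
    ∫⁻ ω, ENNReal.ofReal (exp (3 / (8 * c) * U ω ^ 2)) ∂P ≤ 2 := by
  have hc' : (0 : ℝ) < c := by exact_mod_cast hc
  set γ := gaussianReal 0 1
  -- With this `r`, a Gaussian average of `exp (r u g)` is `exp (3 u² / (8c))`, while the moment
  -- generating function of `U` at `r g` is at most `exp (3 g² / 8)`. Against the Gaussian density
  -- there remains `exp (-g² / 8)`, whose normalised integral is exactly `2`.
  set r : ℝ := √(3 / (4 * c)) with hr
  have hr2 : r ^ 2 = 3 / (4 * c) := sq_sqrt (by positivity)
  have hUm := h.aemeasurable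
  have e1 : ∀ u : ℝ, ENNReal.ofReal (exp (3 / (8 * c) * u ^ 2)) =
      ∫⁻ g, ENNReal.ofReal (exp (r * u * g)) ∂γ := fun u => by
    rw [← ofReal_integral_eq_lintegral_ofReal (integrable_exp_mul_gaussianReal _)
      (ae_of_all _ fun g => (exp_pos _).le)]
    have := congrFun (mgf_id_gaussianReal (μ := 0) (v := 1)) (r * u)
    simp only [mgf, id] at this
    rw [this, mul_pow, hr2]
    congr 2
    simp only [NNReal.coe_one]
    field_simp; ring
  have e2 : ∀ g : ℝ, ∫⁻ ω, ENNReal.ofReal (exp (r * U ω * g)) ∂P ≤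
      ENNReal.ofReal (exp (3 / 8 * g ^ 2)) := fun g => by
    have hi := h.integrable_exp_mul (r * g)
    have hm := h.mgf_le (r * g)
    have e : ∀ ω, r * U ω * g = r * g * U ω := fun ω => by ring
    simp only [e]
    rw [← ofReal_integral_eq_lintegral_ofReal hi (ae_of_all _ fun g => (exp_pos _).le)]
    refine ENNReal.ofReal_le_ofReal (hm.trans (le_of_eq ?_))
    rw [mul_pow, hr2]; congr 1; field_simp; ring
  simp_rw [e1]
  rw [lintegral_lintegral_swap (by
    refine AEMeasurable.ennreal_ofReal (measurable_exp.comp_aemeasurable ?_)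
    exact ((hUm.comp_fst).const_mul r).mul measurable_snd.aemeasurable)]
  refine (lintegral_mono e2).trans ?_
  rw [show γ = volume.withDensity (gaussianPDF 0 1) from gaussianReal_of_var_ne_zero _ one_ne_zero,
    lintegral_withDensity_eq_lintegral_mul _ (by fun_prop) (by fun_prop)]
  have e3 : ∀ g : ℝ, (gaussianPDF 0 1 * fun g => ENNReal.ofReal (exp (3 / 8 * g ^ 2))) g =
      ENNReal.ofReal ((√(2 * π))⁻¹ * exp (-(1 / 8) * g ^ 2)) := fun g => by
    simp only [Pi.mul_apply, gaussianPDF, gaussianPDFReal]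
    rw [← ENNReal.ofReal_mul (by positivity), mul_assoc, ← exp_add]
    congr 3
    · simp
    · simp; ring
  simp_rw [e3]
  rw [← ofReal_integral_eq_lintegral_ofReal
    ((integrable_exp_neg_mul_sq (by norm_num)).const_mul _) (ae_of_all _ fun g => by positivity),
    integral_const_mul, integral_gaussian]
  refine le_of_eq ?_
  rw [show π / (1 / 8) = 2 ^ 2 * (2 * π) by ring, sqrt_mul (sq_nonneg 2) (2 * π),
    sqrt_sq (by norm_num)]
  have : √(2 * π) ≠ 0 := by positivity
  field_simp
  simp

theorem exp_le_one_add_add_sq_mul (x : ℝ) : exp x ≤ 1 + x + x ^ 2 * exp |x| := by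
  have h2 : 1 ≤ exp |x| := one_le_exp (abs_nonneg x)
  rcases le_total |x| 1 with h | h
  · have := (abs_le.1 (Real.abs_exp_sub_one_sub_id_le h)).2
    nlinarith [sq_nonneg x]
  · rcases le_total 0 x with h0 | h0
    · rw [abs_of_nonneg h0] at *
      have : 1 ≤ x ^ 2 := by nlinarith
      nlinarith
    · have : exp x ≤ 1 := exp_le_one_iff.2 h0
      rw [abs_of_nonpos h0] at *
      nlinarith

/-- In the second-order expansion of `exp (l Y)` the linear term has mean zero. Half of the exponent
`θ |Y|` dominates `exp |l Y|`, the other half the square; the constant is `48 = 8 * 6`. -/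
theorem mgf_le_of_integral_exp_abs_le [IsProbabilityMeasure P] {Y : Ω → ℝ} {θ l : ℝ} (hθ : 0 < θ)
    (hYm : AEStronglyMeasurable Y P) (h0 : ∫ ω, Y ω ∂P = 0)
    (hi : Integrable (fun ω => exp (θ * |Y ω|)) P) (h6 : ∫ ω, exp (θ * |Y ω|) ∂P ≤ 6)
    (hl : |l| ≤ θ / 2) :
    Integrable (fun ω => exp (l * Y ω)) P ∧ mgf Y P l ≤ exp (48 * l ^ 2 / θ ^ 2) := by
  have hlY : ∀ ω, |l * Y ω| ≤ θ * |Y ω| / 2 := fun ω => by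
    rw [abs_mul]; nlinarith [abs_nonneg (Y ω)]
  have hint : Integrable (fun ω => exp (l * Y ω)) P := by
    refine hi.mono' (measurable_exp.comp_aemeasurable
      (hYm.aemeasurable.const_mul l)).aestronglyMeasurable (ae_of_all _ fun ω => ?_)
    rw [norm_eq_abs, abs_of_pos (exp_pos _)]
    refine exp_le_exp.2 ((le_abs_self _).trans ((hlY ω).trans ?_))
    have : 0 ≤ θ * |Y ω| := by positivity
    linarith
  have hYi : Integrable Y P := by
    refine (hi.const_mul θ⁻¹).mono' hYm (ae_of_all _ fun ω => ?_)
    have := add_one_le_exp (θ * |Y ω|)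
    rw [norm_eq_abs, ← div_eq_inv_mul, le_div_iff₀ hθ]
    linarith
  refine ⟨hint, ?_⟩
  have hpt : ∀ ω, exp (l * Y ω) ≤ (1 + l * Y ω) + 8 * l ^ 2 / θ ^ 2 * exp (θ * |Y ω|) := by
    intro ω
    refine (exp_le_one_add_add_sq_mul _).trans (add_le_add le_rfl ?_)
    set z := θ * |Y ω| / 2 with hz
    have hz0 : 0 ≤ z := by positivity
    have hz2 : z ^ 2 ≤ 2 * exp z := by
      have := quadratic_le_exp_of_nonneg hz0
      linarith
    have e1 : (l * Y ω) ^ 2 = 4 * l ^ 2 / θ ^ 2 * z ^ 2 := by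
      rw [mul_pow, ← sq_abs (Y ω), hz]; field_simp; ring
    have e2 : θ * |Y ω| = z + z := by rw [hz]; ring
    rw [e1, e2, exp_add]
    calc 4 * l ^ 2 / θ ^ 2 * z ^ 2 * exp |l * Y ω|
        ≤ 4 * l ^ 2 / θ ^ 2 * (2 * exp z) * exp z := by gcongr; exact hlY ω
      _ = _ := by ring
  have hi1 : Integrable (fun ω => 1 + l * Y ω) P := (integrable_const _).add (hYi.const_mul l)
  have hle : mgf Y P l ≤ ∫ ω, ((1 + l * Y ω) + 8 * l ^ 2 / θ ^ 2 * exp (θ * |Y ω|)) ∂P :=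
    integral_mono hint (hi1.add (hi.const_mul _)) hpt
  rw [integral_add hi1 (hi.const_mul _), integral_add (integrable_const _) (hYi.const_mul l),
    integral_const_mul, integral_const_mul, h0] at hle
  simp only [integral_const, probReal_univ, smul_eq_mul, one_mul, mul_zero, add_zero] at hle
  have h1 : 8 * l ^ 2 / θ ^ 2 * ∫ ω, exp (θ * |Y ω|) ∂P ≤ 8 * l ^ 2 / θ ^ 2 * 6 := by gcongr
  have h2 := add_one_le_exp (48 * l ^ 2 / θ ^ 2)
  have h3 : 8 * l ^ 2 / θ ^ 2 * 6 = 48 * l ^ 2 / θ ^ 2 := by ring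
  linarith

/-- By `|UV| ≤ (U² + V²) / 2` and convexity, `exp (θ |UV|)` is at most the average `W` of the two
exponential squares, of mean at most `2`. Centring costs a factor `e`, because `θ |𝔼 UV| ≤ 𝔼 W - 1 ≤
1`; and `2 e < 6`. -/
theorem integral_exp_abs_mul_sub_le [IsProbabilityMeasure P] {U V : Ω → ℝ} {c : ℝ≥0} (hc : 0 < c)
    (hU : HasSubgaussianMGF U c P) (hV : HasSubgaussianMGF V c P) :
    Integrable (fun ω => U ω * V ω) P ∧
    Integrable (fun ω => exp (3 / (8 * c) * |U ω * V ω - ∫ ω, U ω * V ω ∂P|)) P ∧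
    ∫ ω, exp (3 / (8 * c) * |U ω * V ω - ∫ ω, U ω * V ω ∂P|) ∂P ≤ 6 := by
  have hc' : (0 : ℝ) < c := by exact_mod_cast hc
  have hUm := hU.aemeasurable
  have hVm := hV.aemeasurable
  obtain ⟨hUi, hU2⟩ := integrable_exp_sq_of_lintegral_le (by fun_prop) (hU.lintegral_exp_sq_le hc)
  obtain ⟨hVi, hV2⟩ := integrable_exp_sq_of_lintegral_le (by fun_prop) (hV.lintegral_exp_sq_le hc)
  set θ : ℝ := 3 / (8 * c) with hθ
  have hθ0 : 0 < θ := by positivity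
  set W : Ω → ℝ := fun ω => (1 / 2) * (exp (θ * U ω ^ 2) + exp (θ * V ω ^ 2)) with hW
  have hWi : Integrable W P := (hUi.add hVi).const_mul _
  have hW2 : ∫ ω, W ω ∂P ≤ 2 := by
    simp only [hW]
    rw [integral_const_mul, integral_add hUi hVi]
    linarith
  have hUV : ∀ ω, |U ω * V ω| ≤ (U ω ^ 2 + V ω ^ 2) / 2 := fun ω => by
    rw [abs_mul, ← sq_abs (U ω), ← sq_abs (V ω)]
    nlinarith [sq_nonneg (|U ω| - |V ω|)]
  have hUVW : ∀ ω, θ * |U ω * V ω| ≤ W ω - 1 := fun ω => by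
    have h1 := add_one_le_exp (θ * U ω ^ 2)
    have h2 := add_one_le_exp (θ * V ω ^ 2)
    have h3 := mul_le_mul_of_nonneg_left (hUV ω) hθ0.le
    simp only [hW]
    linarith
  have hi : Integrable (fun ω => U ω * V ω) P := by
    refine (hWi.const_mul θ⁻¹).mono' (hUm.mul hVm).aestronglyMeasurable (ae_of_all _ fun ω => ?_)
    rw [norm_eq_abs, ← div_eq_inv_mul, le_div_iff₀ hθ0]
    linarith [hUVW ω]
  refine ⟨hi, ?_⟩
  set m := ∫ ω, U ω * V ω ∂P with hm
  have hθm : θ * |m| ≤ 1 := by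
    have h1 : |m| ≤ ∫ ω, |U ω * V ω| ∂P := abs_integral_le_integral_abs
    have h2 : ∫ ω, θ * |U ω * V ω| ∂P ≤ ∫ ω, (W ω - 1) ∂P :=
      integral_mono (hi.abs.const_mul θ) (hWi.sub (integrable_const _)) hUVW
    rw [integral_const_mul, integral_sub hWi (integrable_const _)] at h2
    simp only [integral_const, probReal_univ, smul_eq_mul, one_mul] at h2
    nlinarith
  have hpt : ∀ ω, exp (θ * |U ω * V ω - m|) ≤ exp 1 * W ω := fun ω => by
    have h1 : |U ω * V ω - m| ≤ |U ω * V ω| + |m| := abs_sub _ _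
    have h2 : θ * |U ω * V ω - m| ≤ 1 + (1 / 2 * (θ * U ω ^ 2) + 1 / 2 * (θ * V ω ^ 2)) := by
      have := mul_le_mul_of_nonneg_left h1 hθ0.le
      have h3 := mul_le_mul_of_nonneg_left (hUV ω) hθ0.le
      linarith
    refine (exp_le_exp.2 h2).trans ?_
    rw [exp_add]
    refine mul_le_mul_of_nonneg_left ?_ (exp_pos _).le
    have := convexOn_exp.2 (Set.mem_univ (θ * U ω ^ 2)) (Set.mem_univ (θ * V ω ^ 2))
      (by norm_num : (0 : ℝ) ≤ 1 / 2) (by norm_num : (0 : ℝ) ≤ 1 / 2) (by norm_num)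
    simp only [smul_eq_mul] at this
    simp only [hW]
    linarith
  have hYi : Integrable (fun ω => exp (θ * |U ω * V ω - m|)) P := by
    refine (hWi.const_mul (exp 1)).mono' ?_ (ae_of_all _ fun ω => ?_)
    · exact AEMeasurable.aestronglyMeasurable (by fun_prop)
    · rw [norm_eq_abs, abs_of_pos (exp_pos _)]
      exact hpt ω
  refine ⟨hYi, (integral_mono hYi (hWi.const_mul _) hpt).trans ?_⟩
  rw [integral_const_mul]
  have := exp_one_lt_d9
  nlinarith [exp_pos 1]

theorem measureReal_sum_ge_le_of_mgf_le {Ω' : Type*} [MeasurableSpace Ω'] {P' : Measure Ω'}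
    [IsProbabilityMeasure P'] {n : ℕ} {Y : Ω → ℝ} {Ys : Fin n → Ω' → ℝ}
    (hind : iIndepFun Ys P') (hid : ∀ i, IdentDistrib (Ys i) Y P' P) {l B t : ℝ} (hl : 0 ≤ l)
    (hi : Integrable (fun ω => exp (l * Y ω)) P) (hB : mgf Y P l ≤ exp B) :
    P'.real {ω | n * t ≤ ∑ i, Ys i ω} ≤ exp (n * (B - l * t)) := by
  have hint : ∀ i, Integrable (fun ω => exp (l * Ys i ω)) P' := fun i =>
    ((hid i).comp (u := fun y => exp (l * y)) (by fun_prop)).integrable_iff.2 hi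
  have hsum : Integrable (fun ω => exp (l * (∑ i, Ys i) ω)) P' := by
    -- If the exponential of the sum were not integrable, its integral would be `0` by convention,
    -- while the product formula makes it a product of positive factors.
    by_contra h
    have h1 := hind.mgf_sum₀ (t := l) (fun i => (hid i).aemeasurable_fst) Finset.univ
    rw [mgf, integral_undef h] at h1
    exact (Finset.prod_pos fun i _ => mgf_pos (hint i)).ne h1
  have h1 := measure_ge_le_exp_mul_mgf (X := ∑ i, Ys i) (μ := P') (n * t) hl hsum
  simp only [Finset.sum_apply] at h1
  refine h1.trans ?_
  rw [hind.mgf_sum₀ (fun i => (hid i).aemeasurable_fst)]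
  have h2 : ∏ i, mgf (Ys i) P' l ≤ exp (n * B) := by
    calc ∏ i, mgf (Ys i) P' l ≤ ∏ _i : Fin n, exp B := by
          refine Finset.prod_le_prod (fun i _ => mgf_nonneg) fun i _ => ?_
          rw [congrFun (mgf_congr_identDistrib (hid i)) l]
          exact hB
      _ = exp (n * B) := by simp [exp_nat_mul]
  calc exp (-l * (n * t)) * ∏ i, mgf (Ys i) P' l ≤ exp (-l * (n * t)) * exp (n * B) := by gcongr
    _ = _ := by rw [← exp_add]; ring_nf

/-- Bernstein's inequality for averages of products of sub-Gaussian variables. -/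
theorem measureReal_abs_sum_mul_sub_ge_le {Ω' : Type*} [MeasurableSpace Ω'] {P' : Measure Ω'}
    [IsProbabilityMeasure P] [IsProbabilityMeasure P'] {n : ℕ} {U V : Ω → ℝ}
    {Us Vs : Fin n → Ω' → ℝ} {c : ℝ≥0} (hc : 0 < c)
    (hU : HasSubgaussianMGF U c P) (hV : HasSubgaussianMGF V c P)
    (hind : iIndepFun (fun i ω => Us i ω * Vs i ω) P')
    (hid : ∀ i, IdentDistrib (fun ω => Us i ω * Vs i ω) (fun ω => U ω * V ω) P' P)
    {t : ℝ} (ht : 0 ≤ t) (ht' : 3 / (8 * c) * t ≤ 48) :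
    P'.real {ω | n * t ≤ |∑ i, (Us i ω * Vs i ω - ∫ ω, U ω * V ω ∂P)|} ≤
      2 * exp (-(n * ((3 / (8 * c)) ^ 2 * t ^ 2 / 192))) := by
  have hc' : (0 : ℝ) < c := by exact_mod_cast hc
  obtain ⟨hUV, hi, h6⟩ := integral_exp_abs_mul_sub_le hc hU hV
  set θ : ℝ := 3 / (8 * c) with hθ
  have hθ0 : 0 < θ := by positivity
  set m := ∫ ω, U ω * V ω ∂P with hm
  set Y : Ω → ℝ := fun ω => U ω * V ω - m with hY
  have h0 : ∫ ω, Y ω ∂P = 0 := by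
    simp only [hY]
    rw [integral_sub hUV (integrable_const _)]
    simp [hm]
  -- This minimises `48 l² / θ² - l t`, with value `-θ² t² / 192`; the bound `θ t ≤ 48` is what
  -- makes `l ≤ θ / 2`.
  set l := θ ^ 2 * t / 96 with hl
  have hl0 : 0 ≤ l := by positivity
  have hl2 : |l| ≤ θ / 2 := by rw [abs_of_nonneg hl0, hl]; nlinarith
  have hYm : AEStronglyMeasurable Y P := hUV.1.sub aestronglyMeasurable_const
  obtain ⟨hp, hpB⟩ := mgf_le_of_integral_exp_abs_le hθ0 hYm h0 hi h6 hl2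
  obtain ⟨hn, hnB⟩ := mgf_le_of_integral_exp_abs_le (Y := fun ω => -Y ω) hθ0 hYm.neg
    (by rw [integral_neg, h0, neg_zero]) (by simpa using hi) (by simpa using h6) hl2
  have b1 := measureReal_sum_ge_le_of_mgf_le (t := t)
    (hind.comp (fun _ x => x - m) fun _ => by fun_prop)
    (fun i => (hid i).comp (u := fun x => x - m) (by fun_prop)) hl0 hp hpB
  have b2 := measureReal_sum_ge_le_of_mgf_le (t := t)
    (hind.comp (fun _ x => -(x - m)) fun _ => by fun_prop)
    (fun i => (hid i).comp (u := fun x => -(x - m)) (by fun_prop)) hl0 hn hnB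
  have e : (n : ℝ) * (48 * l ^ 2 / θ ^ 2 - l * t) = -(n * (θ ^ 2 * t ^ 2 / 192)) := by
    rw [hl]; field_simp; ring
  rw [e] at b1 b2
  have hsub : {ω | n * t ≤ |∑ i, (Us i ω * Vs i ω - m)|} ⊆
      {ω | n * t ≤ ∑ i, ((fun x => x - m) ∘ fun ω => Us i ω * Vs i ω) ω} ∪
      {ω | n * t ≤ ∑ i, ((fun x => -(x - m)) ∘ fun ω => Us i ω * Vs i ω) ω} := by
    intro ω hω
    simp only [Set.mem_ofPred_eq, Set.mem_union, Function.comp, Finset.sum_neg_distrib] at *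
    exact le_abs.1 hω
  refine (measureReal_mono hsub).trans ((measureReal_union_le _ _).trans ?_)
  linarith

end SubGaussian

/-! ### Nets on the sphere and quadratic forms. -/

section Net

theorem dotProduct_self_eq_norm_sq {p : ℕ} (x : Fin p → ℝ) :
    x ⬝ᵥ x = ‖WithLp.toLp 2 x‖ ^ 2 := by
  rw [EuclideanSpace.real_norm_sq_eq]
  simp [dotProduct, sq]

theorem dotProduct_self_nonneg' {p : ℕ} (x : Fin p → ℝ) : 0 ≤ x ⬝ᵥ x := by
  rw [dotProduct_self_eq_norm_sq]; positivity

theorem dotProduct_sq_le {p : ℕ} (x y : Fin p → ℝ) : (x ⬝ᵥ y) ^ 2 ≤ (x ⬝ᵥ x) * (y ⬝ᵥ y) := by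
  have := Finset.sum_mul_sq_le_sq_mul_sq Finset.univ x y
  simpa [dotProduct, sq] using this

/-- A `1/2`-net of the unit sphere with at most `5 ^ p` points. -/
theorem exists_half_net (p : ℕ) : ∃ N : Finset (Fin p → ℝ), N.card ≤ 5 ^ p ∧
    (∀ u ∈ N, u ⬝ᵥ u = 1) ∧ ∀ x, x ⬝ᵥ x = 1 → ∃ u ∈ N, (x - u) ⬝ᵥ (x - u) ≤ 1 / 4 := by
  classical
  -- Volume comparison allows at most `5 ^ p` points of norm at most `2` at mutual distance at least
  -- `1`. A family of maximal size on the sphere of radius `2`, halved, is the net.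
  let S : Set (Finset (EuclideanSpace ℝ (Fin p))) := {s | (∀ c ∈ s, ‖c‖ = 2) ∧
    ∀ c ∈ s, ∀ d ∈ s, c ≠ d → 1 ≤ ‖c - d‖}
  have hcard : ∀ s ∈ S, s.card ≤ 5 ^ p := fun s hs => by
    have := Besicovitch.card_le_of_separated s (fun c hc => (hs.1 c hc).le) hs.2
    rwa [finrank_euclideanSpace_fin] at this
  have hbdd : BddAbove (Finset.card '' S) := ⟨5 ^ p, by rintro _ ⟨s, hs, rfl⟩; exact hcard s hs⟩
  obtain ⟨s, hs, hsmax⟩ := Nat.sSup_mem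
    (⟨0, ∅, ⟨by simp, by simp⟩, rfl⟩ : (Finset.card '' S).Nonempty) hbdd
  refine ⟨s.image fun c => (1 / 2 : ℝ) • c.ofLp, Finset.card_image_le.trans (hcard s hs), ?_, ?_⟩
  · intro u hu
    obtain ⟨c, hc, rfl⟩ := Finset.mem_image.1 hu
    rw [dotProduct_self_eq_norm_sq, WithLp.toLp_smul, norm_smul, WithLp.toLp_ofLp, hs.1 c hc]
    norm_num
  · intro x hx
    set y : EuclideanSpace ℝ (Fin p) := (2 : ℝ) • WithLp.toLp 2 x with hy
    have hy2 : ‖y‖ = 2 := by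
      rw [dotProduct_self_eq_norm_sq] at hx
      have : ‖WithLp.toLp 2 x‖ = 1 :=
        (pow_eq_one_iff_of_nonneg (norm_nonneg _) two_ne_zero).1 hx
      rw [hy, norm_smul, this]; norm_num
    have hex : ∃ c ∈ s, ‖y - c‖ < 1 := by
      by_contra! hcon
      have hys : y ∉ s := fun h => by
        have := hcon y h
        simp at this
        linarith
      have hins : insert y s ∈ S := by
        refine ⟨fun c hc => ?_, fun c hc d hd hcd => ?_⟩
        · rcases Finset.mem_insert.1 hc with rfl | hc
          exacts [hy2, hs.1 c hc]
        · rcases Finset.mem_insert.1 hc with rfl | hc <;>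
            rcases Finset.mem_insert.1 hd with rfl | hd
          · exact absurd rfl hcd
          · exact hcon d hd
          · rw [norm_sub_rev]; exact hcon c hc
          · exact hs.2 c hc d hd hcd
      have h1 := le_csSup hbdd ⟨_, hins, rfl⟩
      rw [← hsmax, Finset.card_insert_of_notMem hys] at h1
      omega
    obtain ⟨c, hc, hyc⟩ := hex
    refine ⟨_, Finset.mem_image_of_mem _ hc, ?_⟩
    have e : WithLp.toLp 2 (x - (1 / 2 : ℝ) • c.ofLp) = (1 / 2 : ℝ) • (y - c) := by
      rw [hy, smul_sub, smul_smul, WithLp.toLp_sub, WithLp.toLp_smul, WithLp.toLp_ofLp]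
      norm_num
    rw [dotProduct_self_eq_norm_sq, e, norm_smul, mul_pow]
    have := norm_nonneg (y - c)
    norm_num
    nlinarith

theorem quadForm_smul {p : ℕ} (B : Matrix (Fin p) (Fin p) ℝ) (a : ℝ) (x : Fin p → ℝ) :
    (a • x) ⬝ᵥ B.mulVec (a • x) = a ^ 2 * (x ⬝ᵥ B.mulVec x) := by
  simp only [Matrix.mulVec_smul, smul_dotProduct, dotProduct_smul, smul_eq_mul]; ring

/-- A quadratic form that is small on a `1/2`-net is small on the whole space. -/
theorem abs_quadForm_le_of_net {p : ℕ} {B : Matrix (Fin p) (Fin p) ℝ} {N : Finset (Fin p → ℝ)}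
    {δ : ℝ} (hN : ∀ x, x ⬝ᵥ x = 1 → ∃ u ∈ N, (x - u) ⬝ᵥ (x - u) ≤ 1 / 4)
    (hN1 : ∀ u ∈ N, u ⬝ᵥ u = 1) (hB : ∀ u ∈ N, |u ⬝ᵥ B.mulVec u| ≤ δ) (x : Fin p → ℝ) :
    |x ⬝ᵥ B.mulVec x| ≤ 32 * δ * (x ⬝ᵥ x) := by
  set q : (Fin p → ℝ) → ℝ := fun x => x ⬝ᵥ B.mulVec x with hq
  have hscale : ∀ {m : ℝ}, (∀ z, z ⬝ᵥ z = 1 → |q z| ≤ m) → ∀ z, |q z| ≤ m * (z ⬝ᵥ z) := by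
    intro m hm z
    rcases (dotProduct_self_nonneg' z).eq_or_lt with h0 | h0
    · have : z = 0 := dotProduct_self_eq_zero.1 h0.symm
      simp [hq, this]
    · set r := √(z ⬝ᵥ z)
      have hr : r ^ 2 = z ⬝ᵥ z := Real.sq_sqrt h0.le
      have hr0 : r ≠ 0 := (Real.sqrt_pos.2 h0).ne'
      have h1 := hm (r⁻¹ • z) (by
        rw [smul_dotProduct, dotProduct_smul, smul_eq_mul, smul_eq_mul, ← hr]; field_simp)
      have h2 : q z = r ^ 2 * q (r⁻¹ • z) := by
        simp only [hq]; rw [quadForm_smul]; field_simp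
      rw [h2, abs_mul, abs_of_nonneg (sq_nonneg r), hr, mul_comm]
      exact mul_le_mul_of_nonneg_right h1 h0.le
  refine hscale (fun z hz => ?_) x
  have hqc : Continuous q := by
    simp only [hq]
    exact continuous_id.dotProduct (Continuous.matrix_mulVec continuous_const continuous_id)
  have hK : IsCompact {x : Fin p → ℝ | x ⬝ᵥ x = 1} := by
    refine Metric.isCompact_of_isClosed_isBounded
      (isClosed_eq (continuous_id.dotProduct continuous_id) continuous_const)
      ((Metric.isBounded_closedBall (x := 0) (r := 1)).subset fun x hx => ?_)
    rw [mem_closedBall_zero_iff, pi_norm_le_iff_of_nonneg zero_le_one]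
    intro i
    have h1 : x i * x i ≤ x ⬝ᵥ x :=
      Finset.single_le_sum (f := fun i => x i * x i) (fun i _ => mul_self_nonneg _)
        (Finset.mem_univ i)
    rw [Set.mem_ofPred_eq] at hx
    rw [hx] at h1
    exact abs_le_one_iff_mul_self_le_one.2 h1
  obtain ⟨x0, hx0, hmax⟩ := hK.exists_isMaxOn ⟨z, hz⟩ hqc.abs.continuousOn
  rw [Set.mem_ofPred_eq] at hx0
  set m := |q x0| with hm
  have hmz : ∀ z, z ⬝ᵥ z = 1 → |q z| ≤ m := fun z hz => hmax hz
  refine (hmz z hz).trans ?_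
  obtain ⟨u, hu, hux⟩ := hN x0 hx0
  have hu1 := hN1 u hu
  have hexp : ∀ a b : ℝ, q (a • x0 + b • u) = a ^ 2 * q x0 + b ^ 2 * q u +
      a * b * (x0 ⬝ᵥ B.mulVec u + u ⬝ᵥ B.mulVec x0) := fun a b => by
    simp only [hq, Matrix.mulVec_add, Matrix.mulVec_smul, smul_dotProduct, dotProduct_smul,
      dotProduct_add, add_dotProduct, smul_eq_mul]; ring
  have hnorm : ∀ a b : ℝ, (a • x0 + b • u) ⬝ᵥ (a • x0 + b • u) =
      a ^ 2 + b ^ 2 + 2 * (a * b) * (x0 ⬝ᵥ u) := fun a b => by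
    simp only [smul_dotProduct, dotProduct_smul,
      dotProduct_add, add_dotProduct, smul_eq_mul, hx0, hu1, dotProduct_comm u x0]; ring
  have hxu : 7 / 8 ≤ x0 ⬝ᵥ u := by
    simp only [sub_dotProduct, dotProduct_sub, hx0, hu1, dotProduct_comm u x0] at hux
    linarith
  -- The two test vectors are `(x0 + u) / 2 ± 2 (x0 - u)`. Their forms differ by `4 (q x0 - q u)`,
  -- and since `x0 + u ⟂ x0 - u` their squared lengths are at most `31 / 16`. Hence `|q x0 - q u| ≤
  -- (31 / 32) m`, so `m ≤ 32 δ`; `B` need not be symmetric.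
  have h1 := hscale hmz ((5 / 2 : ℝ) • x0 + (-3 / 2 : ℝ) • u)
  have h2 := hscale hmz ((-3 / 2 : ℝ) • x0 + (5 / 2 : ℝ) • u)
  rw [hexp, hnorm] at h1 h2
  have hm0 : 0 ≤ m := abs_nonneg _
  have hb := hB u hu
  have h3 : m * ((5 / 2) ^ 2 + (-3 / 2) ^ 2 + 2 * (5 / 2 * (-3 / 2)) * (x0 ⬝ᵥ u)) ≤ m * (31 / 16) :=
    mul_le_mul_of_nonneg_left (by linarith) hm0
  have h4 : m * ((-3 / 2) ^ 2 + (5 / 2) ^ 2 + 2 * (-3 / 2 * (5 / 2)) * (x0 ⬝ᵥ u)) ≤ m * (31 / 16) :=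
    mul_le_mul_of_nonneg_left (by linarith) hm0
  have h5 := abs_le.1 (h1.trans h3)
  have h6 := abs_le.1 (h2.trans h4)
  have h7 := abs_le.1 hb
  change -δ ≤ q u ∧ q u ≤ δ at h7
  have : m ≤ δ + 31 / 32 * m := by
    rw [hm]
    refine abs_le.2 ⟨?_, ?_⟩ <;> rw [← hm] <;> linarith
  linarith

end Net

/-! ### Eigenvalues, the choice of `v`, and square roots. -/

section Spectral

theorem exists_mulVec_eq_of_rank {m k : ℕ} {B : Matrix (Fin m) (Fin k) ℝ} (h : B.rank = m)
    (y : Fin m → ℝ) : ∃ x, B.mulVec x = y := by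
  have : LinearMap.range B.mulVecLin = ⊤ :=
    Submodule.eq_top_of_finrank_eq (by rw [← Matrix.rank, h]; simp)
  exact LinearMap.range_eq_top.1 this y

theorem dotProduct_mulVec_transpose {m k : ℕ} (B : Matrix (Fin m) (Fin k) ℝ) (x : Fin m → ℝ)
    (y : Fin k → ℝ) : x ⬝ᵥ B.mulVec y = B.transpose.mulVec x ⬝ᵥ y := by
  rw [Matrix.dotProduct_mulVec, Matrix.mulVec_transpose]

/-- A nonzero eigenvalue at sorted position `k` or later (counting from `0`) would force `k + 1`
nonzero ones, exceeding the rank. The default value `0` of `ordEig` out of range is harmless, the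
eigenvalue being positive. -/
theorem ordEig_le_of_eigenvalues_ne_zero {d : ℕ} {Q : Matrix (Fin d) (Fin d) ℝ}
    (hQ : Q.PosSemidef) {k : ℕ} (hk : Q.rank ≤ k) (i : Fin d) (hi : hQ.1.eigenvalues i ≠ 0) :
    ordEig Q k ≤ hQ.1.eigenvalues i := by
  have hpos : 0 < hQ.1.eigenvalues i := lt_of_le_of_ne (hQ.eigenvalues_nonneg i) hi.symm
  unfold ordEig
  split_ifs with h
  · obtain ⟨h1, hk1, hkd⟩ := h
    set e := (Fintype.equivOfCardEq (Fintype.card_fin (Fintype.card (Fin d))) :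
      Fin (Fintype.card (Fin d)) ≃ Fin d)
    have hev : ∀ j, hQ.1.eigenvalues j = hQ.1.eigenvalues₀ (e.symm j) := fun j => rfl
    rcases lt_or_ge (e.symm i).1 k with hlt | hge
    · rw [hev]
      refine hQ.1.eigenvalues₀_antitone ?_
      rw [Fin.le_def]
      simp only
      omega
    · exfalso
      have hlt : ∀ a : Fin (k + 1), a.1 < Fintype.card (Fin d) := fun a => by
        have := (e.symm i).2
        omega
      let f : Fin (k + 1) → {j // hQ.1.eigenvalues j ≠ 0} := fun a => ⟨e ⟨a.1, hlt a⟩, by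
        rw [hev, Equiv.symm_apply_apply]
        refine (lt_of_lt_of_le hpos ?_).ne'
        rw [hev]
        refine hQ.1.eigenvalues₀_antitone ?_
        rw [Fin.le_def]
        simp only
        omega⟩
      have hf : Function.Injective f := fun a b hab => by
        have := e.injective (Subtype.ext_iff.1 hab)
        simpa [Fin.ext_iff] using this
      have := Fintype.card_le_of_injective f hf
      rw [← hQ.1.rank_eq_card_non_zero_eigs, Fintype.card_fin] at this
      omega
  · exact hpos.le

/-- In an eigenbasis, vectors of the range of `Q` have no component along the kernel, so only
nonzero eigenvalues contribute. -/
theorem ordEig_mul_dotProduct_le {d : ℕ} {Q : Matrix (Fin d) (Fin d) ℝ} (hQ : Q.PosSemidef)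
    {k : ℕ} (hk : Q.rank ≤ k) (w : Fin d → ℝ) :
    ordEig Q k * (Q.mulVec w ⬝ᵥ Q.mulVec w) ≤ Q.mulVec w ⬝ᵥ Q.mulVec (Q.mulVec w) := by
  obtain ⟨U, hU, hUd⟩ : ∃ U : Matrix (Fin d) (Fin d) ℝ,
      U.transpose * U = 1 ∧ Q = U * Matrix.diagonal hQ.1.eigenvalues * U.transpose := by
    refine ⟨hQ.1.eigenvectorUnitary, ?_, ?_⟩
    · have := Unitary.coe_star_mul_self hQ.1.eigenvectorUnitary
      rwa [Matrix.star_eq_conjTranspose, Matrix.conjTranspose_eq_transpose_of_trivial] at this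
    · have := hQ.1.spectral_theorem
      rw [Unitary.conjStarAlgAut_apply, Matrix.star_eq_conjTranspose,
        Matrix.conjTranspose_eq_transpose_of_trivial] at this
      exact this
  set e := hQ.1.eigenvalues with he
  set z := U.transpose.mulVec w
  have hmul : ∀ x, U.transpose.mulVec (Q.mulVec x) =
      (Matrix.diagonal e).mulVec (U.transpose.mulVec x) := fun x => by
    conv_lhs => rw [hUd]
    simp only [Matrix.mulVec_mulVec]
    rw [← Matrix.mul_assoc, ← Matrix.mul_assoc, hU, Matrix.one_mul]
  have hUU : U * U.transpose = 1 := mul_eq_one_comm.1 hU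
  have hdot : ∀ x y, x ⬝ᵥ y = U.transpose.mulVec x ⬝ᵥ U.transpose.mulVec y := fun x y => by
    rw [← dotProduct_mulVec_transpose, Matrix.mulVec_mulVec, hUU, Matrix.one_mulVec]
  rw [hdot (Q.mulVec w), hdot (Q.mulVec w), hmul (Q.mulVec w), hmul w]
  change _ * (Matrix.diagonal e).mulVec z ⬝ᵥ _ ≤ (Matrix.diagonal e).mulVec z ⬝ᵥ
    (Matrix.diagonal e).mulVec ((Matrix.diagonal e).mulVec z)
  simp only [dotProduct, Matrix.mulVec_diagonal, Finset.mul_sum]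
  refine Finset.sum_le_sum fun i _ => ?_
  rcases eq_or_ne (e i) 0 with h | h
  · simp [h]
  · have h1 := ordEig_le_of_eigenvalues_ne_zero hQ hk i h
    have h2 : 0 ≤ e i * z i * (e i * z i) := mul_self_nonneg _
    calc _ ≤ e i * (e i * z i * (e i * z i)) := mul_le_mul_of_nonneg_right h1 h2
      _ = _ := by ring

/-- A preimage of `β` under `Aᵀ` whose length is controlled by the `K`-th eigenvalue of
`A Σ Aᵀ`. -/
theorem exists_transpose_mulVec_eq {p K : ℕ} {A : Matrix (Fin p) (Fin K) ℝ}
    {S : Matrix (Fin K) (Fin K) ℝ} (hS : S.PosSemidef) (hA : A.rank = K) (hSr : S.rank = K)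
    (β : Fin K → ℝ) : ∃ v, A.transpose.mulVec v = β ∧
      ordEig (A * S * A.transpose) K * (v ⬝ᵥ v) ≤ sqNormOf S β ∧ (sqNormOf S β = 0 → v = 0) := by
  -- Solving `β = Aᵀ A x1`, `x1 = S x2`, `x2 = Aᵀ w` in turn makes `v = A S Aᵀ w` a preimage of `β`
  -- lying in the range of `A S Aᵀ`.
  obtain ⟨x1, h1⟩ := exists_mulVec_eq_of_rank (B := A.transpose * A)
    (by rw [Matrix.rank_transpose_mul_self, hA]) β
  obtain ⟨x2, h2⟩ := exists_mulVec_eq_of_rank hSr x1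
  obtain ⟨w, h3⟩ := exists_mulVec_eq_of_rank (B := A.transpose)
    (by rw [Matrix.rank_transpose, hA]) x2
  have hQ : (A * S * A.transpose).PosSemidef := by
    have := hS.mul_mul_conjTranspose_same A
    rwa [Matrix.conjTranspose_eq_transpose_of_trivial] at this
  have hr : (A * S * A.transpose).rank ≤ K := by
    rw [Matrix.mul_assoc]
    exact (Matrix.rank_mul_le_left _ _).trans hA.le
  have hv : A.transpose.mulVec ((A * S * A.transpose).mulVec w) = β := by
    rw [← h1, ← h2, ← h3]
    simp only [Matrix.mulVec_mulVec, Matrix.mul_assoc]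
  have hq : (A * S * A.transpose).mulVec w ⬝ᵥ
      (A * S * A.transpose).mulVec ((A * S * A.transpose).mulVec w) = sqNormOf S β := by
    rw [sqNormOf, ← hv]
    set v := (A * S * A.transpose).mulVec w
    rw [← Matrix.mulVec_mulVec, ← Matrix.mulVec_mulVec, dotProduct_mulVec_transpose]
  refine ⟨_, hv, (ordEig_mul_dotProduct_le hQ hr w).trans hq.le, fun h0 => ?_⟩
  rw [h0] at hq
  have hz : (A * S * A.transpose).mulVec ((A * S * A.transpose).mulVec w) = 0 :=
    (hQ.dotProduct_mulVec_zero_iff _).1 hq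
  have hQT : (A * S * A.transpose).transpose = A * S * A.transpose := by
    have := hQ.1
    rwa [Matrix.IsHermitian, Matrix.conjTranspose_eq_transpose_of_trivial] at this
  refine dotProduct_self_eq_zero.1 ?_
  rw [dotProduct_mulVec_transpose, hQT, hz, zero_dotProduct]

theorem sqNormOf_le_opNorm_mul {d : ℕ} (Q : Matrix (Fin d) (Fin d) ℝ) (v : Fin d → ℝ) :
    sqNormOf Q v ≤ opNorm Q * (v ⬝ᵥ v) := by
  have h := Matrix.inner_toEuclideanCLM Q (WithLp.toLp 2 v) (WithLp.toLp 2 v)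
  change _ = v ⬝ᵥ Q.mulVec v at h
  rw [sqNormOf, ← h, opNorm, dotProduct_self_eq_norm_sq]
  refine (real_inner_le_norm _ _).trans ?_
  have := (Matrix.toEuclideanCLM (n := Fin d) (𝕜 := ℝ) Q).le_opNorm (WithLp.toLp 2 v)
  nlinarith [norm_nonneg (WithLp.toLp 2 v)]

theorem opNorm_pos {d : ℕ} {Q : Matrix (Fin d) (Fin d) ℝ} (hQ : Q ≠ 0) : 0 < opNorm Q :=
  norm_pos_iff.2 ((map_ne_zero_iff _ (Matrix.toEuclideanCLM (n := Fin d) (𝕜 := ℝ)).injective).2 hQ)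

theorem one_le_condNumber {d : ℕ} {Q : Matrix (Fin d) (Fin d) ℝ} (hQ : Q.PosSemidef)
    (h0 : Q ≠ 0) : 1 ≤ condNumber Q := by
  have hd : 1 ≤ d := by
    by_contra! h
    obtain rfl : d = 0 := by omega
    exact h0 (Subsingleton.elim _ _)
  have h1 : ordEig Q 1 = hQ.1.eigenvalues₀ ⟨0, by rw [Fintype.card_fin]; omega⟩ := by
    rw [ordEig, dif_pos ⟨hQ.1, le_rfl, hd⟩]
  have hd' : ordEig Q d = hQ.1.eigenvalues₀ ⟨d - 1, by rw [Fintype.card_fin]; omega⟩ := by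
    rw [ordEig, dif_pos ⟨hQ.1, hd, le_rfl⟩]
  have hle : ordEig Q d ≤ ordEig Q 1 := by
    rw [h1, hd']
    exact hQ.1.eigenvalues₀_antitone (by simp [Fin.le_def])
  have hpos : 0 < ordEig Q 1 := by
    by_contra! hneg
    refine h0 (hQ.1.eigenvalues_eq_zero_iff.1 (funext fun i => ?_))
    refine le_antisymm (le_trans ?_ hneg) (hQ.eigenvalues_nonneg i)
    rw [h1]
    exact hQ.1.eigenvalues₀_antitone (by simp [Fin.le_def])
  rw [condNumber, ENNReal.le_div_iff_mul_le (Or.inr (by simpa using hpos)) (Or.inl (by simp)),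
    one_mul]
  exact ENNReal.ofReal_le_ofReal hle

open scoped MatrixOrder in
theorem psdSqrt_mul_self {d : ℕ} {Q : Matrix (Fin d) (Fin d) ℝ} (hQ : Q.PosSemidef) :
    psdSqrt Q * psdSqrt Q = Q :=
  CFC.sqrt_mul_sqrt_self Q hQ.nonneg

open scoped MatrixOrder in
theorem psdSqrt_isSymm {d : ℕ} (Q : Matrix (Fin d) (Fin d) ℝ) : (psdSqrt Q).IsSymm := by
  have := (Matrix.nonneg_iff_posSemidef.1 (CFC.sqrt_nonneg Q)).1
  rwa [Matrix.IsHermitian, Matrix.conjTranspose_eq_transpose_of_trivial] at this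

theorem sqNormOf_eq_psdSqrt {d : ℕ} {Q : Matrix (Fin d) (Fin d) ℝ} (hQ : Q.PosSemidef)
    (v : Fin d → ℝ) : sqNormOf Q v = (psdSqrt Q).mulVec v ⬝ᵥ (psdSqrt Q).mulVec v := by
  conv_lhs => rw [sqNormOf, ← psdSqrt_mul_self hQ, ← Matrix.mulVec_mulVec,
    dotProduct_mulVec_transpose, (psdSqrt_isSymm Q).eq]

end Spectral

/-! ### Second moments and sub-Gaussianity of linear functionals. -/

section Covariance

variable {Ω : Type*} [MeasurableSpace Ω] {P : Measure Ω}

theorem memLp_dotProduct {d : ℕ} {V : Ω → Fin d → ℝ} (hV : ∀ j, MemLp (fun ω => V ω j) 2 P)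
    (v : Fin d → ℝ) : MemLp (fun ω => v ⬝ᵥ V ω) 2 P :=
  memLp_finsetSum _ fun j _ => (hV j).const_mul (v j)

variable [IsProbabilityMeasure P]

theorem integral_dotProduct_eq_zero {d : ℕ} {V : Ω → Fin d → ℝ}
    (hV : ∀ j, MemLp (fun ω => V ω j) 2 P) (h0 : ∀ j, ∫ ω, V ω j ∂P = 0) (v : Fin d → ℝ) :
    ∫ ω, v ⬝ᵥ V ω ∂P = 0 := by
  simp only [dotProduct]
  rw [integral_finsetSum _ fun j _ => ((hV j).integrable one_le_two).const_mul (v j)]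
  simp [integral_const_mul, h0]

theorem variance_dotProduct {d : ℕ} {V : Ω → Fin d → ℝ}
    (hV : ∀ j, MemLp (fun ω => V ω j) 2 P) (v : Fin d → ℝ) :
    Var[fun ω => v ⬝ᵥ V ω; P] = sqNormOf (covMat P V) v := by
  rw [← covariance_self (memLp_dotProduct hV v).aemeasurable]
  simp only [dotProduct]
  rw [covariance_fun_sum_fun_sum (fun j => (hV j).const_mul (v j))
    (fun j => (hV j).const_mul (v j))]
  simp only [sqNormOf, dotProduct, Matrix.mulVec, covMat, Matrix.of_apply, Finset.mul_sum,
    covariance_const_mul_left, covariance_const_mul_right]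
  refine Finset.sum_congr rfl fun i _ => Finset.sum_congr rfl fun j _ => ?_
  ring

theorem integral_dotProduct_sq {d : ℕ} {V : Ω → Fin d → ℝ}
    (hV : ∀ j, MemLp (fun ω => V ω j) 2 P) (h0 : ∀ j, ∫ ω, V ω j ∂P = 0) (v : Fin d → ℝ) :
    ∫ ω, (v ⬝ᵥ V ω) ^ 2 ∂P = sqNormOf (covMat P V) v := by
  rw [← variance_dotProduct hV, variance_of_integral_eq_zero (memLp_dotProduct hV v).aemeasurable
    (integral_dotProduct_eq_zero hV h0 v)]

theorem covMat_posSemidef {d : ℕ} {V : Ω → Fin d → ℝ}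
    (hV : ∀ j, MemLp (fun ω => V ω j) 2 P) : (covMat P V).PosSemidef := by
  refine Matrix.posSemidef_iff_dotProduct_mulVec.2 ⟨?_, fun x => ?_⟩
  · ext i j
    simp [covMat, covariance_comm]
  · have := variance_dotProduct hV x
    rw [sqNormOf] at this
    simp only [star_trivial]
    rw [← this]
    exact variance_nonneg _ _

/-- Linear functionals of a vector with independent standardized sub-Gaussian coordinates in its
whitened basis are sub-Gaussian at the scale of their variance. -/
theorem hasSubgaussianMGF_dotProduct {d : ℕ} {V Vt : Ω → Fin d → ℝ} {M : ℝ} (hM : 0 < M)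
    (hV : ∀ j, MemLp (fun ω => V ω j) 2 P) (hind : iIndepFun (fun j ω => Vt ω j) P)
    (hsub : ∀ j, IsStandardSubGaussian P M (fun ω => Vt ω j))
    (heq : ∀ᵐ ω ∂P, V ω = (psdSqrt (covMat P V)).mulVec (Vt ω)) (v : Fin d → ℝ) :
    HasSubgaussianMGF (fun ω => v ⬝ᵥ V ω)
      (8 * M ^ 2 * sqNormOf (covMat P V) v).toNNReal P := by
  set S := psdSqrt (covMat P V)
  set u := S.mulVec v with hu
  have h1 := HasSubgaussianMGF.sum_of_iIndepFun (s := Finset.univ)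
    (hind.comp (fun j x => u j * x) fun j => by fun_prop)
    fun j _ => ((hsub j).toIsCenteredSubGaussian.hasSubgaussianMGF hM).const_mul (u j)
  have h2 : (fun ω => v ⬝ᵥ V ω) =ᵐ[P]
      fun ω => ∑ j, ((fun x => u j * x) ∘ fun ω => Vt ω j) ω := by
    filter_upwards [heq] with ω hω
    rw [hω, dotProduct_mulVec_transpose, (psdSqrt_isSymm _).eq]
    rfl
  refine (h1.congr h2.symm).mono (le_of_eq ?_)
  ext
  rw [sqNormOf_eq_psdSqrt (covMat_posSemidef hV), Real.coe_toNNReal _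
    (mul_nonneg (by positivity) (dotProduct_self_nonneg' _))]
  rw [NNReal.coe_sum]
  change _ = 8 * M ^ 2 * (u ⬝ᵥ u)
  rw [dotProduct, Finset.mul_sum]
  refine Finset.sum_congr rfl fun j _ => ?_
  change u j ^ 2 * ((8 * M ^ 2).toNNReal : ℝ) = _
  rw [Real.coe_toNNReal _ (by positivity)]
  ring

end Covariance

/-! ### Deterministic analysis of the pseudo-inverse estimator. -/

section LeastSquares

theorem transpose_mulVec_pinv {n p : ℕ} (B : Matrix (Fin n) (Fin p) ℝ) (y : Fin n → ℝ) :
    B.transpose.mulVec (B.mulVec ((pinv B).mulVec y)) = B.transpose.mulVec y := by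
  have h := pinv_spec B
  have h1 : B.transpose * (B * pinv B) = B.transpose := by
    conv_lhs => rw [← h.symm_left.eq, ← Matrix.transpose_mul, h.mul_mul_self]
  rw [Matrix.mulVec_mulVec, Matrix.mulVec_mulVec, Matrix.mul_assoc, h1]

/-- The matrix `pinv S * S` is symmetric and idempotent, hence an orthogonal projection. -/
theorem dotProduct_pinv_self_le {p : ℕ} (S : Matrix (Fin p) (Fin p) ℝ) (u : Fin p → ℝ) :
    (pinv S * S).mulVec u ⬝ᵥ (pinv S * S).mulVec u ≤ u ⬝ᵥ u := by
  have h := pinv_spec S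
  have h1 : (pinv S * S).mulVec u ⬝ᵥ (pinv S * S).mulVec u = u ⬝ᵥ (pinv S * S).mulVec u := by
    rw [dotProduct_mulVec_transpose, h.symm_right.eq, Matrix.mulVec_mulVec,
      show pinv S * S * (pinv S * S) = pinv S * S by rw [← Matrix.mul_assoc, h.self_mul_mul],
      dotProduct_comm]
  have h2 := dotProduct_sq_le u ((pinv S * S).mulVec u)
  rw [← h1] at h2
  set a := (pinv S * S).mulVec u ⬝ᵥ (pinv S * S).mulVec u
  have ha : 0 ≤ a := dotProduct_self_nonneg' _
  have hu : 0 ≤ u ⬝ᵥ u := dotProduct_self_nonneg' _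
  rcases ha.eq_or_lt with h0 | h0
  · rw [← h0]; exact hu
  · nlinarith

/-- If the empirical second moments of the whitened vectors `W i` agree with their population
counterparts on a net, they dominate half of the population ones everywhere. -/
theorem dotProduct_le_sum_sq_of_net {n p : ℕ} {S T : Matrix (Fin p) (Fin p) ℝ}
    {N : Finset (Fin p → ℝ)} {W : Fin n → Fin p → ℝ} (hS : S.IsSymm) (hT : S * T * S = S)
    (hN1 : ∀ u ∈ N, u ⬝ᵥ u = 1) (hN : ∀ x, x ⬝ᵥ x = 1 → ∃ u ∈ N, (x - u) ⬝ᵥ (x - u) ≤ 1 / 4)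
    (h : ∀ u ∈ N, |∑ i, ((u ⬝ᵥ W i) * (u ⬝ᵥ W i) - (S * T.transpose).mulVec u ⬝ᵥ
      (S * T.transpose).mulVec u)| ≤ n * (1 / 64)) (b : Fin p → ℝ) :
    n / 2 * (S.mulVec b ⬝ᵥ S.mulVec b) ≤ ∑ i, (S.mulVec b ⬝ᵥ W i) ^ 2 := by
  set G := (S * T.transpose).transpose * (S * T.transpose) with hG
  set B : Matrix (Fin p) (Fin p) ℝ := ∑ i, (Matrix.vecMulVec (W i) (W i) - G) with hB
  have hq : ∀ u, u ⬝ᵥ B.mulVec u = ∑ i, ((u ⬝ᵥ W i) * (u ⬝ᵥ W i) -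
      (S * T.transpose).mulVec u ⬝ᵥ (S * T.transpose).mulVec u) := fun u => by
    rw [hB, Matrix.sum_mulVec, dotProduct_sum]
    refine Finset.sum_congr rfl fun i _ => ?_
    rw [Matrix.sub_mulVec, dotProduct_sub, Matrix.vecMulVec_mulVec, hG, ← Matrix.mulVec_mulVec,
      dotProduct_mulVec_transpose, Matrix.transpose_transpose]
    simp [dotProduct_comm (W i) u]
  -- The tolerance `n / 64` on the net becomes `32 n / 64 = n / 2` everywhere.
  have h1 := abs_quadForm_le_of_net hN hN1 (B := B) (fun u hu => by rw [hq]; exact h u hu)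
    (S.mulVec b)
  -- On the range of `S` the population Gram form is the identity, so the deviation bound compares
  -- directly with `n ‖S b‖²`.
  have h2 : (S * T.transpose).mulVec (S.mulVec b) = S.mulVec b := by
    have := congrArg Matrix.transpose hT
    rw [Matrix.transpose_mul, Matrix.transpose_mul, hS.eq, ← Matrix.mul_assoc] at this
    rw [Matrix.mulVec_mulVec, this]
  rw [hq, h2] at h1
  have h3 := (abs_le.1 h1).1
  rw [Finset.sum_sub_distrib] at h3
  simp only [Finset.sum_const, Finset.card_univ, Fintype.card_fin, nsmul_eq_mul] at h3
  simp only [sq]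
  linarith

/-- Deterministic error bound for the least squares estimator. -/
theorem pinv_mulVec_sub_le {n p : ℕ} (hn : 0 < n) {B : Matrix (Fin n) (Fin p) ℝ}
    {S : Matrix (Fin p) (Fin p) ℝ} {W : Fin n → Fin p → ℝ} {y e h : Fin n → ℝ} {v : Fin p → ℝ}
    (hy : y = B.mulVec v + e - h)
    (hW : ∀ i b, b ⬝ᵥ B i = S.mulVec b ⬝ᵥ W i)
    (hlow : ∀ b, n / 2 * (S.mulVec b ⬝ᵥ S.mulVec b) ≤ ∑ i, (S.mulVec b ⬝ᵥ W i) ^ 2) :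
    S.mulVec ((pinv B).mulVec y - v) ⬝ᵥ S.mulVec ((pinv B).mulVec y - v) ≤
      8 / (n : ℝ) ^ 2 * (∑ j, (∑ i, W i j * e i) ^ 2) + 4 / n * (h ⬝ᵥ h) := by
  have hn' : (0 : ℝ) < n := by exact_mod_cast hn
  set d := (pinv B).mulVec y - v with hd
  set s := S.mulVec d ⬝ᵥ S.mulVec d
  set g : Fin p → ℝ := fun j => ∑ i, W i j * e i with hg
  have hBd : ∀ i, B.mulVec d i = S.mulVec d ⬝ᵥ W i := fun i => by
    rw [← hW, dotProduct_comm]; rfl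
  have h1 : B.mulVec d ⬝ᵥ B.mulVec d = B.mulVec d ⬝ᵥ e - B.mulVec d ⬝ᵥ h := by
    rw [← dotProduct_sub]
    have e1 : B.transpose.mulVec (B.mulVec d) = B.transpose.mulVec (e - h) := by
      rw [hd, Matrix.mulVec_sub, Matrix.mulVec_sub, transpose_mulVec_pinv, ← Matrix.mulVec_sub, hy]
      congr 1
      abel
    rw [dotProduct_mulVec_transpose, e1, dotProduct_comm, dotProduct_mulVec_transpose,
      Matrix.transpose_transpose]
  have h2 : B.mulVec d ⬝ᵥ e = S.mulVec d ⬝ᵥ g := by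
    simp only [dotProduct, hg, Finset.mul_sum]
    rw [Finset.sum_comm]
    refine Finset.sum_congr rfl fun i _ => ?_
    rw [hBd, dotProduct, Finset.sum_mul]
    refine Finset.sum_congr rfl fun j _ => ?_
    ring
  have h3 : n / 2 * s ≤ B.mulVec d ⬝ᵥ B.mulVec d := by
    refine (hlow d).trans (le_of_eq ?_)
    simp only [dotProduct, hBd, sq]
  have young : ∀ (m : ℕ) (x z : Fin m → ℝ) (r : ℝ), 0 < r →
      x ⬝ᵥ z ≤ r * (x ⬝ᵥ x) + 1 / (4 * r) * (z ⬝ᵥ z) := fun m x z r hr => by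
    simp only [dotProduct, Finset.mul_sum, ← Finset.sum_add_distrib]
    refine Finset.sum_le_sum fun i _ => ?_
    have h5 : 0 ≤ r * (x i - 1 / (2 * r) * z i) ^ 2 := by positivity
    have h6 : r * (x i - 1 / (2 * r) * z i) ^ 2 =
        r * (x i * x i) + 1 / (4 * r) * (z i * z i) - x i * z i := by field_simp; ring
    linarith
  -- The weights make each cross term cost `a / 4`, where `a = ‖B d‖²`: the first through `n s / 8 ≤
  -- a / 4`, the second directly. Half of `a` survives on the left.
  have h4 := young _ (S.mulVec d) g (n / 8) (by positivity)
  have h5 := young _ (B.mulVec d) (-h) (1 / 4) (by norm_num)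
  rw [dotProduct_neg, neg_dotProduct, dotProduct_neg, neg_neg] at h5
  have h6 : g ⬝ᵥ g = ∑ j, (∑ i, W i j * e i) ^ 2 := by simp only [dotProduct, hg, sq]
  rw [← h6]
  change S.mulVec d ⬝ᵥ g ≤ n / 8 * s + _ at h4
  set a := B.mulVec d ⬝ᵥ B.mulVec d
  have h7 : a ≤ 4 / n * (g ⬝ᵥ g) + 2 * (h ⬝ᵥ h) := by
    have : 1 / (4 * ((n : ℝ) / 8)) = 2 / n := by field_simp; norm_num
    rw [this] at h4
    have e4 : 4 / (n : ℝ) * (g ⬝ᵥ g) = 2 * (2 / n * (g ⬝ᵥ g)) := by ring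
    rw [e4]
    norm_num at h5
    linarith
  have h8 : s ≤ 2 / n * a := by
    rw [div_mul_eq_mul_div, le_div_iff₀ hn']
    linarith
  refine h8.trans ((mul_le_mul_of_nonneg_left h7 (by positivity)).trans (le_of_eq ?_))
  field_simp
  ring

end LeastSquares

/-! ### Excess risk decomposition and the bias term. -/

section Risk

theorem dotProduct_features {Ω : Type*} {p K : ℕ} {A : Matrix (Fin p) (Fin K) ℝ}
    {Z : Ω → Fin K → ℝ} {E : Ω → Fin p → ℝ} (v : Fin p → ℝ) (ω : Ω) :
    v ⬝ᵥ features A Z E ω = A.transpose.mulVec v ⬝ᵥ Z ω + v ⬝ᵥ E ω := by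
  rw [features, dotProduct_add, dotProduct_mulVec_transpose]

variable {Ω : Type*} [MeasurableSpace Ω] {P : Measure Ω}
  {p K : ℕ} {A : Matrix (Fin p) (Fin K) ℝ} {β : Fin K → ℝ} {Z : Ω → Fin K → ℝ}
  {E : Ω → Fin p → ℝ} {ε : Ω → ℝ}

theorem IsFactorTriple.memLp_features (h : IsFactorTriple P Z E ε) (j : Fin p) :
    MemLp (fun ω => features A Z E ω j) 2 P :=
  (memLp_dotProduct h.memLp_Z (A j)).add (h.memLp_E j)

theorem IsFactorTriple.integral_mul_noise (h : IsFactorTriple P Z E ε) (a : Fin K → ℝ)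
    (b : Fin p → ℝ) : ∫ ω, (a ⬝ᵥ Z ω + b ⬝ᵥ E ω) * ε ω ∂P = 0 := by
  have hZε : IndepFun (fun ω => a ⬝ᵥ Z ω) ε P :=
    h.indep_Z_noise.comp (φ := fun z => a ⬝ᵥ z) (ψ := Prod.snd)
      (by simp only [dotProduct]; fun_prop) measurable_snd
  have hEε : IndepFun (fun ω => b ⬝ᵥ E ω) ε P :=
    h.indep_E_ε.comp (φ := fun z => b ⬝ᵥ z) (ψ := id)
      (by simp only [dotProduct]; fun_prop) measurable_id
  have mZ := memLp_dotProduct h.memLp_Z a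
  have mE := memLp_dotProduct h.memLp_E b
  simp only [add_mul]
  have iZ : Integrable (fun ω => a ⬝ᵥ Z ω * ε ω) P := mZ.integrable_mul h.memLp_ε
  have iE : Integrable (fun ω => b ⬝ᵥ E ω * ε ω) P := mE.integrable_mul h.memLp_ε
  rw [integral_add iZ iE,
    hZε.integral_fun_mul_eq_mul_integral mZ.1 h.memLp_ε.1,
    hEε.integral_fun_mul_eq_mul_integral mE.1 h.memLp_ε.1, h.mean_ε]
  simp

variable [IsProbabilityMeasure P]

theorem IsFactorTriple.mean_features (h : IsFactorTriple P Z E ε) (j : Fin p) :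
    ∫ ω, features A Z E ω j ∂P = 0 := by
  have h1 := integral_dotProduct_eq_zero h.memLp_Z h.mean_Z (A j)
  change ∫ ω, (A j ⬝ᵥ Z ω + E ω j) ∂P = 0
  rw [integral_add ((memLp_dotProduct h.memLp_Z (A j)).integrable one_le_two)
    ((h.memLp_E j).integrable one_le_two), h1, h.mean_E, add_zero]

/-- The residual `Xᵀ α - y` equals `(α - v)ᵀ X + vᵀ E - ε`. The noise is orthogonal to the rest,
which leaves `Var ε` plus the second moment of a sum of two terms. -/
theorem IsFactorTriple.risk_sub_variance_le (h : IsFactorTriple P Z E ε) {v : Fin p → ℝ}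
    (hv : A.transpose.mulVec v = β) (α : Fin p → ℝ) :
    risk P (features A Z E) (response β Z ε) α - Var[ε; P] ≤
      2 * sqNormOf (covMat P (features A Z E)) (α - v) + 2 * sqNormOf (covMat P E) v := by
  set X := features A Z E
  set F : Ω → ℝ := fun ω => (α - v) ⬝ᵥ X ω + v ⬝ᵥ E ω with hF
  have mX : MemLp (fun ω => (α - v) ⬝ᵥ X ω) 2 P := memLp_dotProduct h.memLp_features _
  have mE : MemLp (fun ω => v ⬝ᵥ E ω) 2 P := memLp_dotProduct h.memLp_E v
  have mF : MemLp F 2 P := mX.add mE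
  have hres : ∀ ω, X ω ⬝ᵥ α - response β Z ε ω = F ω - ε ω := fun ω => by
    have h1 := dotProduct_features (A := A) (Z := Z) (E := E) v ω
    rw [hv] at h1
    simp only [hF, response, sub_dotProduct]
    change v ⬝ᵥ X ω = _ at h1
    rw [h1, dotProduct_comm α, dotProduct_comm (Z ω)]
    ring
  have hFε : ∫ ω, F ω * ε ω ∂P = 0 := by
    rw [← h.integral_mul_noise (A.transpose.mulVec (α - v)) α]
    congr 1; ext ω
    simp only [hF, X]
    rw [dotProduct_features, sub_dotProduct α v (E ω)]
    ring
  have hrisk : risk P X (response β Z ε) α = ∫ ω, F ω ^ 2 ∂P + Var[ε; P] := by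
    rw [risk, variance_of_integral_eq_zero h.memLp_ε.aemeasurable h.mean_ε]
    simp only [hres]
    have e : ∀ ω, (F ω - ε ω) ^ 2 = F ω ^ 2 + (ε ω ^ 2 - 2 * (F ω * ε ω)) := fun ω => by ring
    have iFε : Integrable (fun ω => 2 * (F ω * ε ω)) P := (mF.integrable_mul h.memLp_ε).const_mul 2
    have iεF : Integrable (fun ω => ε ω ^ 2 - 2 * (F ω * ε ω)) P :=
      h.memLp_ε.integrable_sq.sub iFε
    simp only [e]
    rw [integral_add mF.integrable_sq iεF,
      integral_sub h.memLp_ε.integrable_sq iFε, integral_const_mul, hFε]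
    simp
  have hle : ∫ ω, F ω ^ 2 ∂P ≤ ∫ ω, (2 * ((α - v) ⬝ᵥ X ω) ^ 2 + 2 * (v ⬝ᵥ E ω) ^ 2) ∂P := by
    refine integral_mono mF.integrable_sq
      ((mX.integrable_sq.const_mul 2).add (mE.integrable_sq.const_mul 2)) fun ω => ?_
    simp only [hF]
    nlinarith [sq_nonneg ((α - v) ⬝ᵥ X ω - v ⬝ᵥ E ω)]
  rw [integral_add (mX.integrable_sq.const_mul 2) (mE.integrable_sq.const_mul 2),
    integral_const_mul, integral_const_mul, integral_dotProduct_sq h.memLp_features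
    h.mean_features, integral_dotProduct_sq h.memLp_E h.mean_E] at hle
  rw [hrisk]
  linarith

theorem ofReal_sqNormOf_le_condNumber_mul {SE : Matrix (Fin p) (Fin p) ℝ}
    {SZ : Matrix (Fin K) (Fin K) ℝ} (hE : SE.PosSemidef) (hZ : SZ.PosSemidef) {v : Fin p → ℝ}
    (hv : ordEig (A * SZ * A.transpose) K * (v ⬝ᵥ v) ≤ sqNormOf SZ β)
    (hv0 : sqNormOf SZ β = 0 → v = 0) :
    ENNReal.ofReal (sqNormOf SE v) ≤
      condNumber SE * (ENNReal.ofReal (sqNormOf SZ β) / snr A SZ SE) := by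
  by_cases hSE : SE = 0
  · simp [hSE, sqNormOf]
  refine le_trans ?_ (mul_le_mul_left (one_le_condNumber hE hSE) _)
  rw [one_mul]
  have hb : 0 ≤ sqNormOf SZ β := by
    rw [sqNormOf_eq_psdSqrt hZ]; exact dotProduct_self_nonneg' _
  rcases hb.eq_or_lt with h0 | hb0
  · simp [hv0 h0.symm, sqNormOf]
  have ho := opNorm_pos hSE
  rcases le_or_gt (ordEig (A * SZ * A.transpose) K) 0 with hl | hl
  -- Here the ratio `ξ` is `0`, and a positive numerator over `0` is `∞`.
  · rw [snr, ENNReal.ofReal_of_nonpos hl, ENNReal.zero_div, ENNReal.div_zero (by simpa using hb0)]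
    exact le_top
  · rw [snr, ← ENNReal.ofReal_div_of_pos ho, ← ENNReal.ofReal_div_of_pos (by positivity)]
    refine ENNReal.ofReal_le_ofReal ((sqNormOf_le_opNorm_mul SE v).trans ?_)
    rw [le_div_iff₀ (by positivity)]
    calc opNorm SE * (v ⬝ᵥ v) * (ordEig (A * SZ * A.transpose) K / opNorm SE)
        = ordEig (A * SZ * A.transpose) K * (v ⬝ᵥ v) := by field_simp
      _ ≤ _ := hv

end Risk

/-! ### Concentration of the three empirical quantities. -/

section Sample

open scoped NNReal

variable {Ω Ω' : Type*} [MeasurableSpace Ω] [MeasurableSpace Ω'] {P : Measure Ω} {P' : Measure Ω'}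
  {n p K : ℕ} {A : Matrix (Fin p) (Fin K) ℝ} {Z : Ω → Fin K → ℝ} {E : Ω → Fin p → ℝ} {ε : Ω → ℝ}
  {Zs : Fin n → Ω' → Fin K → ℝ} {Es : Fin n → Ω' → Fin p → ℝ} {εs : Fin n → Ω' → ℝ}

theorem measurable_dotProduct_const {d : ℕ} (u : Fin d → ℝ) :
    Measurable fun x : Fin d → ℝ => u ⬝ᵥ x :=
  (continuous_const.dotProduct continuous_id).measurable

theorem measurable_mulVec {m d : ℕ} (B : Matrix (Fin m) (Fin d) ℝ) :
    Measurable fun x : Fin d → ℝ => B.mulVec x :=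
  (Continuous.matrix_mulVec continuous_const continuous_id).measurable

theorem IsIIDSample.ae_forall (h : IsIIDSample P Z E ε P' Zs Es εs)
    {q : (Fin K → ℝ) × (Fin p → ℝ) × ℝ → Prop} (hq : MeasurableSet {x | q x})
    (hP : ∀ᵐ ω ∂P, q (Z ω, E ω, ε ω)) : ∀ᵐ ω ∂P', ∀ i, q (Zs i ω, Es i ω, εs i ω) :=
  ae_all_iff.2 fun i => (h.identDistrib i).symm.ae_snd hq hP

variable [IsProbabilityMeasure P] [IsProbabilityMeasure P']

theorem IsIIDSample.measureReal_abs_sum_mul_ge_le (h : IsIIDSample P Z E ε P' Zs Es εs)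
    {f g : (Fin K → ℝ) × (Fin p → ℝ) × ℝ → ℝ} (hf : Measurable f) (hg : Measurable g) {c : ℝ≥0}
    (hc : 0 < c) (hU : HasSubgaussianMGF (fun ω => f (Z ω, E ω, ε ω)) c P)
    (hV : HasSubgaussianMGF (fun ω => g (Z ω, E ω, ε ω)) c P) {t m : ℝ}
    (hm : ∫ ω, f (Z ω, E ω, ε ω) * g (Z ω, E ω, ε ω) ∂P = m)
    (ht : 0 ≤ t) (ht' : 3 / (8 * c) * t ≤ 48) :
    P'.real {ω | n * t ≤
      |∑ i, (f (Zs i ω, Es i ω, εs i ω) * g (Zs i ω, Es i ω, εs i ω) - m)|} ≤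
      2 * Real.exp (-(n * ((3 / (8 * c)) ^ 2 * t ^ 2 / 192))) := by
  subst hm
  exact measureReal_abs_sum_mul_sub_ge_le (P := P) (P' := P')
    (U := fun ω => f (Z ω, E ω, ε ω)) (V := fun ω => g (Z ω, E ω, ε ω))
    (Us := fun i ω => f (Zs i ω, Es i ω, εs i ω)) (Vs := fun i ω => g (Zs i ω, Es i ω, εs i ω))
    hc hU hV (h.indep.comp (fun _ x => f x * g x) fun _ => hf.mul hg)
    (fun i => (h.identDistrib i).comp (u := fun x => f x * g x) (hf.mul hg)) ht ht'

/-- The whitened features `Σ_X^{-1/2} X`. -/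
noncomputable def whitened (SX : Matrix (Fin p) (Fin p) ℝ) (x : Fin p → ℝ) : Fin p → ℝ :=
  (pinv (psdSqrt SX)).mulVec x

theorem dotProduct_whitened (SX : Matrix (Fin p) (Fin p) ℝ) (u x : Fin p → ℝ) :
    u ⬝ᵥ whitened SX x = (pinv (psdSqrt SX)).transpose.mulVec u ⬝ᵥ x :=
  dotProduct_mulVec_transpose _ _ _

theorem sqNormOf_whitened {SX : Matrix (Fin p) (Fin p) ℝ} (hX : SX.PosSemidef) (u : Fin p → ℝ) :
    sqNormOf SX ((pinv (psdSqrt SX)).transpose.mulVec u) =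
      (psdSqrt SX * (pinv (psdSqrt SX)).transpose).mulVec u ⬝ᵥ
        (psdSqrt SX * (pinv (psdSqrt SX)).transpose).mulVec u := by
  rw [sqNormOf_eq_psdSqrt hX, Matrix.mulVec_mulVec]

/-- Whitened features have an orthogonal projection as covariance, the identity only when `Σ_X` is
invertible; their variances therefore never exceed `1`. -/
theorem sqNormOf_whitened_le {SX : Matrix (Fin p) (Fin p) ℝ} (hX : SX.PosSemidef)
    (u : Fin p → ℝ) : sqNormOf SX ((pinv (psdSqrt SX)).transpose.mulVec u) ≤ u ⬝ᵥ u := by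
  rw [sqNormOf_whitened hX]
  have h1 : psdSqrt SX * (pinv (psdSqrt SX)).transpose = pinv (psdSqrt SX) * psdSqrt SX := by
    conv_rhs => rw [← (pinv_spec (psdSqrt SX)).symm_right.eq, Matrix.transpose_mul,
      (psdSqrt_isSymm SX).eq]
  rw [h1]
  exact dotProduct_pinv_self_le _ _

theorem measurable_dotProduct_whitened (SX : Matrix (Fin p) (Fin p) ℝ) (u : Fin p → ℝ) :
    Measurable fun x : (Fin K → ℝ) × (Fin p → ℝ) × ℝ => u ⬝ᵥ whitened SX (A.mulVec x.1 + x.2.1) :=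
  (measurable_dotProduct_const u).comp ((measurable_mulVec _).comp
    (((measurable_mulVec A).comp measurable_fst).add (measurable_fst.comp measurable_snd)))

/-- Bernstein at level `1 / 64` for each net point, where `786432 = 192 * 64²`, then a union bound.
The condition `1 ≤ c` keeps this level in the sub-Gaussian regime. -/
theorem IsIIDSample.measureReal_gram_le (h : IsIIDSample P Z E ε P' Zs Es εs)
    (hT : IsFactorTriple P Z E ε) {c : ℝ≥0} (hc : 1 ≤ c)
    (hsub : ∀ u : Fin p → ℝ, u ⬝ᵥ u = 1 → HasSubgaussianMGF
      (fun ω => u ⬝ᵥ whitened (covMat P (features A Z E)) (features A Z E ω)) c P)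
    {N : Finset (Fin p → ℝ)} (hN1 : ∀ u ∈ N, u ⬝ᵥ u = 1) (hN : N.card ≤ 5 ^ p) :
    P'.real {ω | ∃ u ∈ N, n * (1 / 64) ≤
      |∑ i, ((u ⬝ᵥ whitened (covMat P (features A Z E)) (features A (Zs i) (Es i) ω)) *
        (u ⬝ᵥ whitened (covMat P (features A Z E)) (features A (Zs i) (Es i) ω)) -
        (psdSqrt (covMat P (features A Z E)) *
          (pinv (psdSqrt (covMat P (features A Z E)))).transpose).mulVec u ⬝ᵥ
        (psdSqrt (covMat P (features A Z E)) *
          (pinv (psdSqrt (covMat P (features A Z E)))).transpose).mulVec u)|} ≤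
      2 * (5 ^ p * Real.exp (-(n * ((3 / (8 * c)) ^ 2 / 786432)))) := by
  set SX := covMat P (features A Z E)
  have hX : SX.PosSemidef := covMat_posSemidef hT.memLp_features
  have hc' : (1 : ℝ) ≤ c := by exact_mod_cast hc
  have hθ : 3 / (8 * (c : ℝ)) ≤ 1 := by rw [div_le_one (by positivity)]; linarith
  set F : (Fin p → ℝ) → Set Ω' := fun u => {ω | n * (1 / 64) ≤
      |∑ i, ((u ⬝ᵥ whitened SX (features A (Zs i) (Es i) ω)) *
        (u ⬝ᵥ whitened SX (features A (Zs i) (Es i) ω)) -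
        (psdSqrt SX * (pinv (psdSqrt SX)).transpose).mulVec u ⬝ᵥ
        (psdSqrt SX * (pinv (psdSqrt SX)).transpose).mulVec u)|} with hF
  have hone : ∀ u ∈ N, P'.real (F u) ≤
      2 * Real.exp (-(n * ((3 / (8 * c)) ^ 2 / 786432))) := fun u hu => by
    have hu1 := hsub u (hN1 u hu)
    have hm : ∫ ω, (u ⬝ᵥ whitened SX (features A Z E ω)) *
        (u ⬝ᵥ whitened SX (features A Z E ω)) ∂P =
        (psdSqrt SX * (pinv (psdSqrt SX)).transpose).mulVec u ⬝ᵥ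
        (psdSqrt SX * (pinv (psdSqrt SX)).transpose).mulVec u := by
      rw [← sqNormOf_whitened hX, ← integral_dotProduct_sq hT.memLp_features hT.mean_features]
      simp only [dotProduct_whitened, sq]
    refine (h.measureReal_abs_sum_mul_ge_le (measurable_dotProduct_whitened (A := A) SX u)
      (measurable_dotProduct_whitened (A := A) SX u) (lt_of_lt_of_le one_pos hc)
      hu1 hu1 hm (by norm_num) (by linarith)).trans (le_of_eq ?_)
    congr 4
    ring
  have hsubset : {ω | ∃ u ∈ N, ω ∈ F u} ⊆ ⋃ u ∈ N, F u := fun ω hω => by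
    obtain ⟨u, hu, hω⟩ := hω
    exact Set.mem_biUnion hu hω
  refine (measureReal_mono hsubset (measure_ne_top _ _)).trans ((measureReal_biUnion_finset_le _ _).trans ?_)
  refine (Finset.sum_le_sum hone).trans ?_
  rw [Finset.sum_const, nsmul_eq_mul]
  have : (N.card : ℝ) ≤ 5 ^ p := by exact_mod_cast hN
  have := mul_le_mul_of_nonneg_right this
    (Real.exp_pos (-(n * ((3 / (8 * (c : ℝ))) ^ 2 / 786432)))).le
  linarith

theorem IsIIDSample.measureReal_noise_le (h : IsIIDSample P Z E ε P' Zs Es εs)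
    (hT : IsFactorTriple P Z E ε) {c : ℝ≥0} (hc : 0 < c) (hn : 0 < n)
    (hsub : ∀ u : Fin p → ℝ, u ⬝ᵥ u = 1 → HasSubgaussianMGF
      (fun ω => u ⬝ᵥ whitened (covMat P (features A Z E)) (features A Z E ω)) c P)
    {s : ℝ} (hε : HasSubgaussianMGF (fun ω => ε ω / s) c P) :
    P'.real {ω | ∃ j, n * (√(384 * Real.log n / n) / (3 / (8 * c))) ≤
      |∑ i, whitened (covMat P (features A Z E)) (features A (Zs i) (Es i) ω) j *
        (εs i ω / s)|} ≤ p * (2 / (n : ℝ) ^ 2) := by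
  have hc' : (0 : ℝ) < c := by exact_mod_cast hc
  have hn' : (0 : ℝ) < n := by exact_mod_cast hn
  have hn1 : (1 : ℝ) ≤ n := by exact_mod_cast hn
  have hlog : 0 ≤ Real.log n := Real.log_nonneg hn1
  set SX := covMat P (features A Z E)
  set θ : ℝ := 3 / (8 * c) with hθ
  have hθ0 : 0 < θ := by positivity
  -- Chosen so that the Bernstein exponent `n θ² t² / 192` is `2 log n`, giving failure probability
  -- `2 / n²` per coordinate.
  set t := √(384 * Real.log n / n) / θ with ht
  set F : Fin p → Set Ω' := fun j => {ω | n * t ≤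
    |∑ i, whitened SX (features A (Zs i) (Es i) ω) j * (εs i ω / s)|} with hF
  have hθt : θ * t = √(384 * Real.log n / n) := by rw [ht]; field_simp
  have hone : ∀ j, P'.real (F j) ≤ 2 / (n : ℝ) ^ 2 := fun j => by
    have hj : ∀ x : Fin p → ℝ, (Pi.single j 1 : Fin p → ℝ) ⬝ᵥ x = x j := fun x => by
      rw [single_dotProduct, one_mul]
    have hu1 := hsub (Pi.single j 1) (by rw [hj]; simp)
    have hm : ∫ ω, ((Pi.single j 1 : Fin p → ℝ) ⬝ᵥ whitened SX (features A Z E ω)) *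
        (ε ω / s) ∂P = 0 := by
      have h0 := hT.integral_mul_noise
        (A.transpose.mulVec ((pinv (psdSqrt SX)).transpose.mulVec (Pi.single j 1)))
        ((pinv (psdSqrt SX)).transpose.mulVec (Pi.single j 1))
      simp only [dotProduct_whitened, dotProduct_features, mul_div_assoc', integral_div]
      rw [h0, zero_div]
    have hb := h.measureReal_abs_sum_mul_ge_le (t := t)
      (measurable_dotProduct_whitened (A := A) SX (Pi.single j 1))
      (g := fun x => x.2.2 / s) (by fun_prop) hc hu1 hε hm (by positivity) (by
        change θ * t ≤ 48
        rw [hθt, Real.sqrt_le_left (by norm_num), div_le_iff₀ hn']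
        have := Real.log_le_sub_one_of_pos hn'
        linarith)
    simp only [hj, sub_zero] at hb
    refine hb.trans (le_of_eq ?_)
    have e : (n : ℝ) * (θ ^ 2 * t ^ 2 / 192) = Real.log ((n : ℝ) ^ 2) := by
      rw [← mul_pow, hθt, Real.sq_sqrt (by positivity), Real.log_pow]
      push_cast; field_simp; ring
    change 2 * Real.exp (-(n * (θ ^ 2 * t ^ 2 / 192))) = _
    rw [e, Real.exp_neg, Real.exp_log (by positivity), div_eq_mul_inv]
  have hsubset : {ω | ∃ j, ω ∈ F j} ⊆ ⋃ j, F j := fun ω hω => by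
    obtain ⟨j, hω⟩ := hω
    exact Set.mem_iUnion_of_mem j hω
  refine (measureReal_mono hsubset (measure_ne_top _ _)).trans ((measureReal_iUnion_fintype_le _).trans ?_)
  refine (Finset.sum_le_sum fun j _ => hone j).trans ?_
  simp

theorem IsIIDSample.measureReal_error_le (h : IsIIDSample P Z E ε P' Zs Es εs)
    (hT : IsFactorTriple P Z E ε) {c : ℝ≥0} (hc : 1 ≤ c) {v : Fin p → ℝ} {r : ℝ}
    (hr : sqNormOf (covMat P E) v = r ^ 2)
    (hE : HasSubgaussianMGF (fun ω => v ⬝ᵥ E ω / r) c P) :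
    P'.real {ω | n * (1 / 64) + n ≤ ∑ i, (v ⬝ᵥ Es i ω / r) ^ 2} ≤
      2 * Real.exp (-(n * ((3 / (8 * c)) ^ 2 / 786432))) := by
  have hc' : (1 : ℝ) ≤ c := by exact_mod_cast hc
  have hθ : 3 / (8 * (c : ℝ)) ≤ 1 := by rw [div_le_one (by positivity)]; linarith
  set m := ∫ ω, (v ⬝ᵥ E ω / r) * (v ⬝ᵥ E ω / r) ∂P with hm
  have hm1 : m ≤ 1 := by
    simp only [hm, ← sq, div_pow]
    rw [integral_div, integral_dotProduct_sq hT.memLp_E hT.mean_E, hr]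
    -- The mean is `r² / r²`, which is `1`, or `0` by convention when `r = 0`.
    exact div_self_le_one _
  have hf : Measurable fun x : (Fin K → ℝ) × (Fin p → ℝ) × ℝ => v ⬝ᵥ x.2.1 / r :=
    ((measurable_dotProduct_const v).comp (measurable_fst.comp measurable_snd)).div_const r
  have hb := h.measureReal_abs_sum_mul_ge_le hf hf (lt_of_lt_of_le one_pos hc) hE hE hm.symm
    (t := 1 / 64) (by norm_num) (by linarith)
  refine (measureReal_mono fun ω hω => ?_).trans (hb.trans (le_of_eq ?_))
  · simp only [Set.mem_ofPred_eq] at *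
    refine le_trans ?_ (le_abs_self _)
    rw [Finset.sum_sub_distrib]
    simp only [Finset.sum_const, Finset.card_univ, Fintype.card_fin, nsmul_eq_mul, ← sq]
    have : (n : ℝ) * m ≤ n * 1 := mul_le_mul_of_nonneg_left hm1 (Nat.cast_nonneg n)
    linarith
  · congr 4
    ring

end Sample

/-! ### Almost sure identities, uniform constants, and the bound on the good event. -/

section Main

open scoped NNReal

variable {Ω Ω' : Type*} [MeasurableSpace Ω] [MeasurableSpace Ω'] {P : Measure Ω} {P' : Measure Ω'}
  {n p K : ℕ} {A : Matrix (Fin p) (Fin K) ℝ} {β : Fin K → ℝ} {Z : Ω → Fin K → ℝ}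
  {E : Ω → Fin p → ℝ} {ε : Ω → ℝ}
  {Zs : Fin n → Ω' → Fin K → ℝ} {Es : Fin n → Ω' → Fin p → ℝ} {εs : Fin n → Ω' → ℝ}

theorem SubGaussianFactors.noise_eq {M : ℝ} (h : SubGaussianFactors P M Z E ε) :
    ∀ᵐ ω ∂P, ε ω = √Var[ε; P] * (ε ω / √Var[ε; P]) := by
  obtain ⟨-, -, εt, -, heq⟩ := h
  filter_upwards [heq] with ω hω
  rcases eq_or_ne (√Var[ε; P]) 0 with h0 | h0
  · rw [hω, h0]; simp
  · field_simp

/-- Even for singular `Σ_X` whitening loses nothing, because `X` almost surely lies in the range of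
`Σ_X^{1/2}`. -/
theorem SubGaussianData.psdSqrt_mulVec_whitened {M : ℝ} {X : Ω → Fin p → ℝ} {y : Ω → ℝ}
    (h : SubGaussianData P M X y) :
    ∀ᵐ ω ∂P, (psdSqrt (covMat P X)).mulVec (whitened (covMat P X) (X ω)) = X ω := by
  obtain ⟨⟨Xt, -, -, heq⟩, -⟩ := h
  filter_upwards [heq] with ω hω
  rw [hω, whitened, Matrix.mulVec_mulVec, Matrix.mulVec_mulVec,
    (pinv_spec _).mul_mul_self]

variable [IsProbabilityMeasure P]

theorem SubGaussianData.hasSubgaussianMGF_whitened {M : ℝ} (hM : 0 < M) {y : Ω → ℝ}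
    (hT : IsFactorTriple P Z E ε) (h : SubGaussianData P M (features A Z E) y)
    {u : Fin p → ℝ} (hu : u ⬝ᵥ u = 1) :
    HasSubgaussianMGF (fun ω => u ⬝ᵥ whitened (covMat P (features A Z E)) (features A Z E ω))
      (8 * M ^ 2 + 1).toNNReal P := by
  obtain ⟨⟨Xt, hind, hsub, heq⟩, -⟩ := h
  simp only [dotProduct_whitened]
  refine (hasSubgaussianMGF_dotProduct hM hT.memLp_features hind hsub heq _).mono
    (Real.toNNReal_le_toNNReal ?_)
  have := sqNormOf_whitened_le (covMat_posSemidef (P := P) (hT.memLp_features (A := A))) u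
  rw [hu] at this
  have := mul_le_mul_of_nonneg_left this (by positivity : 0 ≤ 8 * M ^ 2)
  linarith

theorem SubGaussianFactors.hasSubgaussianMGF_error {M : ℝ} (hM : 0 < M)
    (hT : IsFactorTriple P Z E ε) (h : SubGaussianFactors P M Z E ε) {v : Fin p → ℝ} {r : ℝ}
    (hr : sqNormOf (covMat P E) v = r ^ 2) :
    HasSubgaussianMGF (fun ω => v ⬝ᵥ E ω / r) (8 * M ^ 2 + 1).toNNReal P := by
  obtain ⟨⟨Et, hind, hsub, heq⟩, -⟩ := h
  have h1 := (hasSubgaussianMGF_dotProduct hM hT.memLp_E hind hsub heq v).const_mul r⁻¹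
  simp only [div_eq_inv_mul]
  refine h1.mono ?_
  rw [← NNReal.coe_le_coe, Real.coe_toNNReal _ (by positivity)]
  change r⁻¹ ^ 2 * ((8 * M ^ 2 * sqNormOf (covMat P E) v).toNNReal : ℝ) ≤ _
  rw [hr, Real.coe_toNNReal _ (by positivity)]
  have h2 : r⁻¹ ^ 2 * r ^ 2 ≤ 1 := by
    rw [inv_pow, inv_mul_eq_div]; exact div_self_le_one _
  have := mul_le_mul_of_nonneg_left h2 (by positivity : 0 ≤ 8 * M ^ 2)
  linarith

theorem SubGaussianFactors.hasSubgaussianMGF_noise {M : ℝ} (hM : 0 < M)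
    (h : SubGaussianFactors P M Z E ε) :
    HasSubgaussianMGF (fun ω => ε ω / √Var[ε; P]) (8 * M ^ 2 + 1).toNNReal P := by
  obtain ⟨-, -, εt, hsub, heq⟩ := h
  rcases eq_or_ne (√Var[ε; P]) 0 with h0 | h0
  · simp only [h0, div_zero]
    exact HasSubgaussianMGF.fun_zero.mono bot_le
  · refine ((hsub.hasSubgaussianMGF hM).mono (Real.toNNReal_le_toNNReal (by linarith))).congr ?_
    filter_upwards [heq] with ω hω
    rw [hω]
    field_simp

/-- Only `r = 0` has content: then `vᵀ E` has zero second moment and vanishes almost surely, so that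
normalising by `r` is legitimate. -/
theorem IsFactorTriple.error_eq (hT : IsFactorTriple P Z E ε) {v : Fin p → ℝ} {r : ℝ}
    (hr : sqNormOf (covMat P E) v = r ^ 2) :
    ∀ᵐ ω ∂P, v ⬝ᵥ E ω = r * (v ⬝ᵥ E ω / r) := by
  rcases eq_or_ne r 0 with h0 | h0
  · have h1 := integral_dotProduct_sq hT.memLp_E hT.mean_E v
    rw [hr, h0, zero_pow two_ne_zero, integral_eq_zero_iff_of_nonneg (fun ω => sq_nonneg _)
      (memLp_dotProduct hT.memLp_E v).integrable_sq] at h1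
    filter_upwards [h1] with ω hω
    have : v ⬝ᵥ E ω = 0 := pow_eq_zero_iff two_ne_zero |>.1 hω
    simp [this]
  · exact ae_of_all _ fun ω => by field_simp

/-- Half of the exponent absorbs `5 ^ p ≤ exp (2p)`; the other half decays at least like its
reciprocal. -/
theorem five_pow_mul_exp_neg_le {n p : ℕ} {k : ℝ} (hk : 0 < k) (hn : 0 < n)
    (h : 4 / k * (p : ℝ) ≤ n) : 5 ^ p * Real.exp (-(n * k)) ≤ 2 / k / n := by
  have hn' : (0 : ℝ) < n := by exact_mod_cast hn
  have h5 : (5 : ℝ) ≤ Real.exp 2 := by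
    have h1 := Real.exp_one_gt_d9
    have : Real.exp 2 = Real.exp 1 * Real.exp 1 := by rw [← Real.exp_add]; norm_num
    nlinarith
  have h4 : 2 * (p : ℝ) ≤ n * k / 2 := by
    rw [div_mul_eq_mul_div, div_le_iff₀ hk] at h
    linarith
  calc 5 ^ p * Real.exp (-(n * k)) ≤ Real.exp 2 ^ p * Real.exp (-(n * k)) := by gcongr
    _ = Real.exp (2 * p - n * k) := by rw [← Real.exp_nat_mul, ← Real.exp_add]; ring_nf
    _ ≤ Real.exp (-(n * k / 2)) := Real.exp_le_exp.2 (by linarith)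
    _ ≤ (n * k / 2)⁻¹ := by
      rw [Real.exp_neg]
      have := Real.add_one_le_exp (n * k / 2)
      gcongr
      linarith
    _ = 2 / k / n := by field_simp

/-- The excess risk on the event where the empirical quantities are close to their means. -/
theorem excess_risk_le_of_good (hT : IsFactorTriple P Z E ε) (hn : 0 < n) {v : Fin p → ℝ}
    (hv : A.transpose.mulVec v = β) {r s θ : ℝ} (hθ : 0 < θ)
    (hr : sqNormOf (covMat P E) v = r ^ 2) {N : Finset (Fin p → ℝ)}
    (hN1 : ∀ u ∈ N, u ⬝ᵥ u = 1) (hN : ∀ x, x ⬝ᵥ x = 1 → ∃ u ∈ N, (x - u) ⬝ᵥ (x - u) ≤ 1 / 4)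
    {z : Fin n → Fin K → ℝ} {e : Fin n → Fin p → ℝ} {t : Fin n → ℝ}
    (hgram : ∀ u ∈ N, |∑ i, ((u ⬝ᵥ whitened (covMat P (features A Z E)) (A.mulVec (z i) + e i)) *
        (u ⬝ᵥ whitened (covMat P (features A Z E)) (A.mulVec (z i) + e i)) -
        (psdSqrt (covMat P (features A Z E)) *
          (pinv (psdSqrt (covMat P (features A Z E)))).transpose).mulVec u ⬝ᵥ
        (psdSqrt (covMat P (features A Z E)) *
          (pinv (psdSqrt (covMat P (features A Z E)))).transpose).mulVec u)| ≤ n * (1 / 64))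
    (hnoise : ∀ j, |∑ i, whitened (covMat P (features A Z E)) (A.mulVec (z i) + e i) j *
        (t i / s)| ≤ n * (√(384 * Real.log n / n) / θ))
    (herr : ∑ i, (v ⬝ᵥ e i / r) ^ 2 ≤ n * (1 / 64) + n)
    (hw : ∀ i, (psdSqrt (covMat P (features A Z E))).mulVec
      (whitened (covMat P (features A Z E)) (A.mulVec (z i) + e i)) = A.mulVec (z i) + e i)
    (ht : ∀ i, t i = s * (t i / s)) (he : ∀ i, v ⬝ᵥ e i = r * (v ⬝ᵥ e i / r)) :
    risk P (features A Z E) (response β Z ε)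
        ((pinv (Matrix.of fun i j => (A.mulVec (z i) + e i) j)).mulVec fun i => z i ⬝ᵥ β + t i) -
        Var[ε; P] ≤
      (6144 / θ ^ 2 + 18) * (r ^ 2 + (p : ℝ) / n * s ^ 2 * Real.log n) := by
  have hn' : (0 : ℝ) < n := by exact_mod_cast hn
  have hlog : 0 ≤ Real.log n := Real.log_nonneg (by exact_mod_cast hn)
  set SX := covMat P (features A Z E)
  set S := psdSqrt SX
  set W : Fin n → Fin p → ℝ := fun i => whitened SX (A.mulVec (z i) + e i) with hW
  set B : Matrix (Fin n) (Fin p) ℝ := Matrix.of fun i j => (A.mulVec (z i) + e i) j with hB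
  have hSX : SX.PosSemidef := covMat_posSemidef hT.memLp_features
  have hlow := dotProduct_le_sum_sq_of_net (psdSqrt_isSymm SX) (pinv_spec S).mul_mul_self hN1 hN
    (W := W) hgram
  have hBW : ∀ i b, b ⬝ᵥ B i = S.mulVec b ⬝ᵥ W i := fun i b => by
    change b ⬝ᵥ (A.mulVec (z i) + e i) = _
    conv_lhs => rw [← hw i, dotProduct_mulVec_transpose, (psdSqrt_isSymm SX).eq]
  -- The sample obeys the linear model with coefficient `v`, noise `t` and perturbation `vᵀ e i`.
  have hy : (fun i => z i ⬝ᵥ β + t i) = B.mulVec v + t - fun i => v ⬝ᵥ e i := by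
    ext i
    have : B.mulVec v i = v ⬝ᵥ (A.mulVec (z i) + e i) := dotProduct_comm _ _
    rw [Pi.sub_apply, Pi.add_apply, this, dotProduct_add, dotProduct_mulVec_transpose, hv,
      dotProduct_comm (z i)]
    ring
  have hmain := pinv_mulVec_sub_le hn hy hBW hlow
  rw [← sqNormOf_eq_psdSqrt hSX] at hmain
  have hnoise2 : ∑ j, (∑ i, W i j * t i) ^ 2 ≤ p * (s ^ 2 * (n * (384 * Real.log n) / θ ^ 2)) := by
    have hj : ∀ j, (∑ i, W i j * t i) ^ 2 ≤ s ^ 2 * (n * (384 * Real.log n) / θ ^ 2) := fun j => by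
      have e1 : ∑ i, W i j * t i = s * ∑ i, W i j * (t i / s) := by
        rw [Finset.mul_sum]
        refine Finset.sum_congr rfl fun i _ => ?_
        conv_lhs => rw [ht i]
        ring
      rw [e1, mul_pow]
      refine mul_le_mul_of_nonneg_left ?_ (sq_nonneg s)
      rw [← sq_abs]
      refine (pow_le_pow_left₀ (abs_nonneg _) (hnoise j) 2).trans (le_of_eq ?_)
      rw [mul_pow, div_pow, Real.sq_sqrt (by positivity)]
      field_simp
    refine (Finset.sum_le_sum fun j _ => hj j).trans ?_
    simp
  have herr2 : (fun i => v ⬝ᵥ e i) ⬝ᵥ (fun i => v ⬝ᵥ e i) ≤ r ^ 2 * (2 * n) := by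
    have e1 : (fun i => v ⬝ᵥ e i) ⬝ᵥ (fun i => v ⬝ᵥ e i) = r ^ 2 * ∑ i, (v ⬝ᵥ e i / r) ^ 2 := by
      rw [dotProduct, Finset.mul_sum]
      refine Finset.sum_congr rfl fun i _ => ?_
      conv_lhs => rw [he i]
      ring
    rw [e1]
    refine mul_le_mul_of_nonneg_left ?_ (sq_nonneg r)
    linarith
  refine (hT.risk_sub_variance_le hv _).trans ?_
  rw [hr]
  -- Here `3072 = 8 * 384`, doubled to `6144` by the risk decomposition. The error term contributes
  -- `2 * 8`, and the bias `2` more, to the constant `18`.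
  have h1 : 8 / (n : ℝ) ^ 2 * (∑ j, (∑ i, W i j * t i) ^ 2) ≤
      3072 / θ ^ 2 * ((p : ℝ) / n * s ^ 2 * Real.log n) := by
    refine (mul_le_mul_of_nonneg_left hnoise2 (by positivity)).trans (le_of_eq ?_)
    field_simp; ring
  have h2 : 4 / n * ((fun i => v ⬝ᵥ e i) ⬝ᵥ (fun i => v ⬝ᵥ e i)) ≤ 8 * r ^ 2 := by
    refine (mul_le_mul_of_nonneg_left herr2 (by positivity)).trans (le_of_eq ?_)
    field_simp; ring
  set x := (p : ℝ) / n * s ^ 2 * Real.log n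
  have hx : 0 ≤ x := by positivity
  have hr0 : 0 ≤ 6144 / θ ^ 2 * r ^ 2 := by positivity
  have e2 : 6144 / θ ^ 2 * x = 2 * (3072 / θ ^ 2 * x) := by ring
  change 2 * sqNormOf SX _ + _ ≤ _
  linarith

end Main

end FactorRegression

/-! ### Choice of constants and union bound. -/

theorem mainTheorem10 (M : ℝ) (hM : 0 < M) :
    ∃ C c C' : ℝ, 0 < C ∧ 0 < c ∧ 0 < C' ∧
      ∀ (n p K : ℕ), 1 ≤ K → K ≤ p → C * (p : ℝ) < (n : ℝ) →
      -- the population `(Z, E, ε)` with `X = A Z + E` and `y = Zᵀ β + ε`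
      ∀ (Ω : Type*) [MeasurableSpace Ω] (P : Measure Ω) [IsProbabilityMeasure P]
        (A : Matrix (Fin p) (Fin K) ℝ) (β : Fin K → ℝ)
        (Z : Ω → Fin K → ℝ) (E : Ω → Fin p → ℝ) (ε : Ω → ℝ),
      FactorRegression.IsFactorTriple P Z E ε →
      A.rank = K → (FactorRegression.covMat P Z).rank = K →
      FactorRegression.SubGaussianData P M (FactorRegression.features A Z E)
        (FactorRegression.response β Z ε) →
      FactorRegression.SubGaussianFactors P M Z E ε →
      -- the training sample
      ∀ (Ω' : Type*) [MeasurableSpace Ω'] (P' : Measure Ω') [IsProbabilityMeasure P']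
        (Zs : Fin n → Ω' → Fin K → ℝ) (Es : Fin n → Ω' → Fin p → ℝ) (εs : Fin n → Ω' → ℝ),
      FactorRegression.IsIIDSample P Z E ε P' Zs Es εs →
      1 - c / (n : ℝ) ≤ P'.real {ω |
        ENNReal.ofReal
            (FactorRegression.risk P (FactorRegression.features A Z E)
                (FactorRegression.response β Z ε)
                (FactorRegression.gls (fun i => FactorRegression.features A (Zs i) (Es i))
                  (fun i => FactorRegression.response β (Zs i) (εs i)) ω)
              - Var[ε; P]) ≤
          ENNReal.ofReal C' *
            (FactorRegression.condNumber (FactorRegression.covMat P E) *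
                (ENNReal.ofReal (FactorRegression.sqNormOf (FactorRegression.covMat P Z) β) /
                  FactorRegression.snr A (FactorRegression.covMat P Z)
                    (FactorRegression.covMat P E)) +
              ENNReal.ofReal ((p : ℝ) / (n : ℝ) * Var[ε; P] * Real.log n))} := by
  open FactorRegression in
  set c₀ := (8 * M ^ 2 + 1).toNNReal with hc₀
  have hc₀1 : 1 ≤ c₀ := by
    rw [hc₀, ← Real.toNNReal_one]
    exact Real.toNNReal_le_toNNReal (by nlinarith [sq_nonneg M])
  have hc₀' : (1 : ℝ) ≤ c₀ := by exact_mod_cast hc₀1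
  set θ : ℝ := 3 / (8 * c₀) with hθ
  have hθ0 : 0 < θ := by positivity
  set k : ℝ := θ ^ 2 / 786432 with hk
  have hk0 : 0 < k := by positivity
  -- In `C`, the `4 / k` pays for the net and the `1` ensures `p ≤ n`. In `c`, the Gram and error
  -- events cost `4 / k` each and the noise event costs `2`.
  refine ⟨4 / k + 1, 8 / k + 2, 6144 / θ ^ 2 + 18, by positivity, by positivity, by positivity,
    fun n p K hK hKp hn Ω _ P _ A β Z E ε hT hA hZr hX hF Ω' _ P' _ Zs Es εs hS => ?_⟩
  have hp1 : (1 : ℝ) ≤ p := by exact_mod_cast hK.trans hKp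
  have hkp : 0 < 4 / k * (p : ℝ) := by positivity
  have hn' : (0 : ℝ) < n := by linarith
  have hn0 : 0 < n := by exact_mod_cast hn'
  have hpn : (p : ℝ) ≤ n := by linarith
  have hZ : (covMat P Z).PosSemidef := covMat_posSemidef hT.memLp_Z
  have hE : (covMat P E).PosSemidef := covMat_posSemidef hT.memLp_E
  obtain ⟨v, hv, hvK, hv0⟩ := exists_transpose_mulVec_eq hZ hA hZr β
  obtain ⟨N, hNc, hN1, hN⟩ := exists_half_net p
  set r := √(sqNormOf (covMat P E) v)
  have hr : sqNormOf (covMat P E) v = r ^ 2 := by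
    rw [Real.sq_sqrt]
    rw [sqNormOf_eq_psdSqrt hE]
    exact dotProduct_self_nonneg' _
  set s := √Var[ε; P]
  have hs : s ^ 2 = Var[ε; P] := Real.sq_sqrt (variance_nonneg _ _)
  have hsubX : ∀ u : Fin p → ℝ, u ⬝ᵥ u = 1 → HasSubgaussianMGF
      (fun ω => u ⬝ᵥ whitened (covMat P (features A Z E)) (features A Z E ω)) c₀ P :=
    fun u hu => hX.hasSubgaussianMGF_whitened hM hT hu
  have b1 := hS.measureReal_gram_le (A := A) hT hc₀1 hsubX hN1 hNc
  have b2 := hS.measureReal_noise_le (A := A) hT (lt_of_lt_of_le one_pos hc₀1) hn0 hsubX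
    (hF.hasSubgaussianMGF_noise hM)
  have b3 := hS.measureReal_error_le hT hc₀1 hr (hF.hasSubgaussianMGF_error hM hT hr)
  set G1 := {ω | ∃ u ∈ N, _}
  set G2 := {ω | ∃ j : Fin p, _}
  set G3 := {ω | n * (1 / 64) + (n : ℝ) ≤ _}
  have a1 : ∀ᵐ ω ∂P', ∀ i, (psdSqrt (covMat P (features A Z E))).mulVec
      (whitened (covMat P (features A Z E)) (A.mulVec (Zs i ω) + Es i ω)) =
      A.mulVec (Zs i ω) + Es i ω := by
    have hmeas : Measurable fun x : (Fin K → ℝ) × (Fin p → ℝ) × ℝ => A.mulVec x.1 + x.2.1 :=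
      ((measurable_mulVec A).comp measurable_fst).add (measurable_fst.comp measurable_snd)
    exact hS.ae_forall (q := fun x => (psdSqrt (covMat P (features A Z E))).mulVec
      (whitened (covMat P (features A Z E)) (A.mulVec x.1 + x.2.1)) = A.mulVec x.1 + x.2.1)
      (measurableSet_eq_fun ((measurable_mulVec _).comp ((measurable_mulVec _).comp hmeas)) hmeas)
      hX.psdSqrt_mulVec_whitened
  have a2 : ∀ᵐ ω ∂P', ∀ i, εs i ω = s * (εs i ω / s) :=
    hS.ae_forall (q := fun x => x.2.2 = s * (x.2.2 / s))
      (measurableSet_eq_fun (by fun_prop) (by fun_prop)) hF.noise_eq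
  have a3 : ∀ᵐ ω ∂P', ∀ i, v ⬝ᵥ Es i ω = r * (v ⬝ᵥ Es i ω / r) := by
    have hmeas : Measurable fun x : (Fin K → ℝ) × (Fin p → ℝ) × ℝ => v ⬝ᵥ x.2.1 :=
      (measurable_dotProduct_const v).comp (measurable_fst.comp measurable_snd)
    exact hS.ae_forall (q := fun x => v ⬝ᵥ x.2.1 = r * (v ⬝ᵥ x.2.1 / r))
      (measurableSet_eq_fun hmeas ((hmeas.div_const r).const_mul r)) (hT.error_eq hr)
  set G : Set Ω' := {ω | _ ≤ ENNReal.ofReal (6144 / θ ^ 2 + 18) * _} with hG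
  have hgood : ∀ᵐ ω ∂P', ω ∉ G1 ∪ G2 ∪ G3 → ω ∈ G := by
    filter_upwards [a1, a2, a3] with ω h1 h2 h3 hω
    simp only [Set.mem_union, not_or] at hω
    obtain ⟨⟨hg1, hg2⟩, hg3⟩ := hω
    have hg1' : ∀ u ∈ N, _ := fun u hu => le_of_lt (not_le.1 fun hle => hg1 ⟨u, hu, hle⟩)
    have hg2' : ∀ j, _ := fun j => le_of_lt (not_le.1 fun hle => hg2 ⟨j, hle⟩)
    have hle := excess_risk_le_of_good hT hn0 hv hθ0 hr hN1 hN hg1' hg2'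
      (le_of_lt (not_le.1 hg3)) h1 h2 h3
    rw [hs] at hle
    have hx : 0 ≤ (p : ℝ) / n * Var[ε; P] * Real.log n :=
      mul_nonneg (mul_nonneg (by positivity) (variance_nonneg _ _))
        (Real.log_nonneg (by exact_mod_cast hn0))
    refine (ENNReal.ofReal_le_ofReal hle).trans ?_
    rw [ENNReal.ofReal_mul (by positivity), ENNReal.ofReal_add (sq_nonneg r) hx, ← hr]
    gcongr
    exact ofReal_sqNormOf_le_condNumber_mul hE hZ hvK hv0
  have hbad : P'.real (G1 ∪ G2 ∪ G3) ≤ (8 / k + 2) / n := by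
    have e1 : (5 : ℝ) ^ p * Real.exp (-(n * k)) ≤ 2 / k / n :=
      five_pow_mul_exp_neg_le hk0 hn0 (by linarith)
    have e3 : Real.exp (-(n * k)) ≤ 2 / k / n := by
      have : (1 : ℝ) ≤ 5 ^ p := one_le_pow₀ (by norm_num)
      nlinarith [Real.exp_pos (-(n * k))]
    have e2 : (p : ℝ) * (2 / (n : ℝ) ^ 2) ≤ 2 / (n : ℝ) := by
      calc (p : ℝ) * (2 / (n : ℝ) ^ 2) ≤ n * (2 / (n : ℝ) ^ 2) := by gcongr
        _ = 2 / (n : ℝ) := by field_simp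
    have e4 : (8 / k + 2) / (n : ℝ) = 2 * (2 / k / n) + 2 / n + 2 * (2 / k / n) := by
      field_simp; ring
    rw [e4]
    refine (measureReal_union_le _ _).trans (add_le_add ((measureReal_union_le _ _).trans
      (add_le_add (b1.trans ?_) (b2.trans e2))) (b3.trans ?_))
    · exact mul_le_mul_of_nonneg_left e1 (by norm_num)
    · exact mul_le_mul_of_nonneg_left e3 (by norm_num)
  have hcompl : P'.real (G1 ∪ G2 ∪ G3)ᶜ ≤ P'.real G := by
    refine ENNReal.toReal_mono (measure_ne_top _ _) (measure_mono_ae ?_)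
    filter_upwards [hgood] with ω hω hmem using hω hmem
  -- Subadditivity suffices here, so measurability of the bad events and of `G` is never required.
  have huniv : (1 : ℝ) ≤ P'.real (G1 ∪ G2 ∪ G3) + P'.real (G1 ∪ G2 ∪ G3)ᶜ := by
    have := measureReal_union_le (μ := P') (G1 ∪ G2 ∪ G3) (G1 ∪ G2 ∪ G3)ᶜ
    rwa [Set.union_compl_self, probReal_univ] at this
  linarith
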